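/- Let $n=n_1n_2$ with integers $n_1,n_2>1$. For an integer $L\ge 1$ let $f=X^n+a_{n-1}X^{n-1}+\dots+a_0$ be a random monic polynomial whose coefficients $a_0,\dots,a_{n-1}$ are chosen independently and uniformly from $\{-L,\dots,L\}$, and let $G_f$ be the Galois group of $f$ over $\mathbb{Q}$, regarded as a permutation group on the set of complex roots of $f$. Say that a permutation group $G$ on a set $\Omega$ of $n$ elements is transitive $(n_1,n_2)$-imprimitive if $G$ is transitive on $\Omega$ and there is a partition $\Omega=\Lambda_1\sqcup\dots\sqcup\Lambda_{n_1}$ into $n_1$ nonempty blocks such that for every $g\in G$ and every $1\le i\le n_1$ there is $1\le j\le n_1$ with $g\Lambda_i=\Lambda_j$ (so $|\Lambda_i|=n_2$ for all $i$). In particular, for $G_f$ this requires $f$ to have $n$ distinct roots. Then for every $\epsilon>0$ there is a constant $K>0$, depending only on $n_1,n_2,\epsilon$, such that for all integers $L\ge1$ \[ \mathrm{Prob}\big(G_f \text{ is transitive } (n_1,n_2)\text{-imprimitive}\big)\le K\,L^{-n+m+\epsilon}, \] where $m=\frac n2-\frac2n+1$ if $n_2=2$ and $n\ge 10$, and \[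 m=\max\Big\{n_2+\tfrac12+\tfrac1{n_1},\ n_1+\big(1-\tfrac1{n_1}\big)(n_2-1),\ n_1+\tfrac{n_2}{2}\Big\} \] otherwise. -/

import Mathlib

open Polynomial

/-- A permutation group `G` on `n₁ * n₂` points is *transitive `(n₁, n₂)`-imprimitive* if it is
transitive and the points can be partitioned into exactly `n₁` (nonempty) blocks that are
permuted among themselves by every element of `G`. -/
def IsTransitiveImprimitive {α : Type*} (G : Subgroup (Equiv.Perm α)) (n₁ n₂ : ℕ) : Prop :=
  Nat.card α = n₁ * n₂ ∧
  MulAction.IsPretransitive G α ∧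
  ∃ Λ : Set (Set α), Setoid.IsPartition Λ ∧ Λ.ncard = n₁ ∧
    ∀ g ∈ G, ∀ B ∈ Λ, g '' B ∈ Λ

/-- The Galois group over `ℚ` of an integral polynomial, as a group of permutations of the set of
its (distinct) complex roots. -/
noncomputable def galoisPermGroup (f : ℤ[X]) :
    Subgroup (Equiv.Perm ((f.map (Int.castRingHom ℚ)).rootSet ℂ)) :=
  haveI : Fact (((f.map (Int.castRingHom ℚ)).map (algebraMap ℚ ℂ)).Splits) :=
    ⟨IsAlgClosed.splits _⟩
  (Polynomial.Gal.galActionHom (f.map (Int.castRingHom ℚ)) ℂ).range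

/-- The monic polynomial `X ^ n + a_{n-1} X ^ (n-1) + ⋯ + a_0`. -/
noncomputable def monicPoly (n : ℕ) (a : Fin n → ℤ) : ℤ[X] :=
  X ^ n + ∑ i : Fin n, C (a i) * X ^ (i : ℕ)

/-- The coefficient vectors of length `n` with entries in `{-L, …, L}`. -/
noncomputable def coeffBox (n L : ℕ) : Finset (Fin n → ℤ) :=
  Fintype.piFinset fun _ => Finset.Icc (-(L : ℤ)) (L : ℤ)

open Classical in
/-- The probability that `P f` holds, for `f` monic of degree `n` whose other coefficients are
chosen uniformly and independently from `{-L, …, L}`. -/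
noncomputable def boxProb (n L : ℕ) (P : ℤ[X] → Prop) : ℝ :=
  (((coeffBox n L).filter fun a => P (monicPoly n a)).card : ℝ) / ((coeffBox n L).card : ℝ)

/-- The exponent `m` attached to `(n₁, n₂)`. -/
noncomputable def imprimitiveExponent (n₁ n₂ : ℕ) : ℝ :=
  if n₂ = 2 ∧ 10 ≤ n₁ * n₂ then
    ((n₁ * n₂ : ℕ) : ℝ) / 2 - 2 / ((n₁ * n₂ : ℕ) : ℝ) + 1
  else
    max ((n₂ : ℝ) + 1 / 2 + 1 / (n₁ : ℝ))
      (max ((n₁ : ℝ) + (1 - 1 / (n₁ : ℝ)) * ((n₂ : ℝ) - 1)) ((n₁ : ℝ) + (n₂ : ℝ) / 2))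

/-! ### Counting lemmas -/

/-! Write `n` for the number of blocks and `k + 1` for their size. If the Galois group of f is
transitive and permutes the blocks, then f is a product of `n` conjugate monic polynomials of degree
`k + 1`, and f is determined by the coefficients of the factors. These form `k + 1` vectors of
algebraic integers indexed by the blocks; an action `ρ` of the absolute Galois group on the indices
plays the role of a number field of degree `n` with labelled embeddings. By multiplicativity of the
Mahler measure, `∏ i, (1 + ∑ j, ‖x j i‖)` is O(L). So it suffices to count the tuples of height at
most H over all `ρ` together (`card_tuples_le`), and to divide by the size of the coefficient box.

Cut the heights dyadically, so that the i-th entries are bounded by `M i`, and put P = ∏ `M i`. For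
each `ρ` let N be the number of equivariant vectors in this box and G the number of those with
distinct entries, the generators. A small integer combination of the members of a tuple is a
generator, so the tuples number O(∑ G N^k), the box being enlarged by a constant
(`card_tuples_le_of_bound`).

Two facts control this sum. A generator determines `ρ` and is a vector of roots of an integral
polynomial with bounded coefficients, so ∑ G = O(P^n) (`sum_ncard_boundedGenerators_le`). A nonzero
vector has norm at least 1, so N = O(P). Where N = O(P^(1-1/n)), the first fact gives
P^(n+(1-1/n)k).

Where N is larger, let q be a constant times P/N and shrink the box to sides `M i ^ θ` of product
q^n. By pigeonhole at least a constant times N q^n / P, that is of q^(n-1), vectors remain. The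
non-generators satisfy a linear relation and also number only O(q^(n-1)); the constant in q makes
them at most half. Hence each such `ρ` has many generators in the small box, while all `ρ` together
have O(q^(n²)) there. This bounds the number of such `ρ` (`card_mul_le_of_le_ncard`), and a dyadic
class of N contributes O(P^(k+1) q^(n(n-1)-k)) with 1 ≤ q ≤ P^(1/n). The extreme values of q give
the two terms of `countExponent`. -/

theorem Set.finite_and_ncard_le_of_forall_finset {α : Type*} {S : Set α} {C : ℝ}
    (h : ∀ F : Finset α, ↑F ⊆ S → (F.card : ℝ) ≤ C) : S.Finite ∧ (S.ncard : ℝ) ≤ C := by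
  have hfin : S.Finite := by
    by_contra hS
    obtain ⟨F, hFS, hF⟩ := Set.Infinite.exists_subset_card_eq hS (⌊C⌋₊ + 1)
    have h1 := h F hFS
    rw [hF] at h1
    push_cast at h1
    linarith [Nat.lt_floor_add_one C]
  refine ⟨hfin, ?_⟩
  rw [Set.ncard_eq_toFinset_card S hfin]
  exact h _ (by simp)

theorem Int.card_Icc_floor_le {r : ℝ} (hr : 1 ≤ r) :
    ((Finset.Icc ⌊-r⌋ ⌊r⌋).card : ℝ) ≤ 4 * r := by
  have h1 := Int.floor_le r
  have h2 := Int.sub_one_lt_floor (-r)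
  have h4 : ⌊-r⌋ ≤ ⌊r⌋ := Int.floor_le_floor (by linarith)
  have h3 : ((Finset.Icc ⌊-r⌋ ⌊r⌋).card : ℤ) = ⌊r⌋ + 1 - ⌊-r⌋ := by
    rw [Int.card_Icc, Int.toNat_of_nonneg (by omega)]
  have h5 : ((Finset.Icc ⌊-r⌋ ⌊r⌋).card : ℝ) = ⌊r⌋ + 1 - ⌊-r⌋ := by exact_mod_cast h3
  rw [h5]
  linarith

/-- If the points of `F` have coordinates bounded by `R` and no box of side lengths `δ` contains
more than `B` points of `F`, then `F` has at most `B * ∏ 4 R / δ` points. -/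
theorem Finset.card_le_mul_prod_of_card_cell_le {α κ : Type*} [Fintype κ] [DecidableEq κ]
    (F : Finset α) (J : Finset κ) (Y : α → κ → ℝ) (R δ : κ → ℝ) (B : ℝ)
    (hδ : ∀ i ∈ J, 0 < δ i) (hRδ : ∀ i ∈ J, δ i ≤ R i) (hY : ∀ x ∈ F, ∀ i ∈ J, |Y x i| ≤ R i)
    (hB : ∀ G ⊆ F, (∀ x ∈ G, ∀ y ∈ G, ∀ i ∈ J, |Y x i - Y y i| < δ i) → (G.card : ℝ) ≤ B) :
    (F.card : ℝ) ≤ B * ∏ i ∈ J, (4 * (R i / δ i)) := by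
  classical
  -- The key is constantly 0 off `J`, so only the coordinates in `J` contribute to the number of
  -- cells.
  let key : α → κ → ℤ := fun x i => if i ∈ J then ⌊Y x i / δ i⌋ else 0
  let T : Finset (κ → ℤ) := Fintype.piFinset fun i =>
    if i ∈ J then Finset.Icc ⌊-(R i / δ i)⌋ ⌊R i / δ i⌋ else {0}
  have hB0 : 0 ≤ B := by simpa using hB ∅ (by simp) (by simp)
  have hmaps : ∀ x ∈ F, key x ∈ T := by
    intro x hx
    rw [Fintype.mem_piFinset]
    intro i
    by_cases hi : i ∈ J
    · simp only [key, hi, if_true, Finset.mem_Icc]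
      have h1 := abs_le.mp (hY x hx i hi)
      have h2 := hδ i hi
      constructor
      · apply Int.floor_le_floor
        rw [← neg_div]
        gcongr
        exact h1.1
      · apply Int.floor_le_floor
        gcongr
        exact h1.2
    · simp [key, hi]
  have hT : (T.card : ℝ) ≤ ∏ i ∈ J, (4 * (R i / δ i)) := by
    rw [Fintype.card_piFinset, Nat.cast_prod]
    rw [← Finset.prod_subset (Finset.subset_univ J)
      (f := fun i => (((if i ∈ J then Finset.Icc ⌊-(R i / δ i)⌋ ⌊R i / δ i⌋ else {0}) :
        Finset ℤ).card : ℝ)) (by intro i _ hi; simp [hi])]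
    apply Finset.prod_le_prod
    · intros; positivity
    · intro i hi
      simp only [hi, if_true]
      exact Int.card_Icc_floor_le ((one_le_div (hδ i hi)).mpr (hRδ i hi))
  rw [Finset.card_eq_sum_card_fiberwise hmaps, Nat.cast_sum]
  calc ∑ t ∈ T, ((F.filter (fun x => key x = t)).card : ℝ) ≤ ∑ t ∈ T, B := by
        apply Finset.sum_le_sum
        intro t _
        apply hB _ (Finset.filter_subset _ _)
        intro x hx y hy i hi
        have hk : key x i = key y i := by
          rw [(Finset.mem_filter.mp hx).2, (Finset.mem_filter.mp hy).2]
        simp only [key, hi, if_true] at hk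
        have h2 := Int.abs_sub_lt_one_of_floor_eq_floor hk
        rw [← sub_div, abs_div, abs_of_pos (hδ i hi), div_lt_one (hδ i hi)] at h2
        exact h2
    _ = B * T.card := by rw [Finset.sum_const, nsmul_eq_mul, mul_comm]
    _ ≤ _ := by gcongr

/-! ### Equivariant vectors of algebraic integers -/

/-- The field of algebraic numbers. -/
noncomputable abbrev QBar : IntermediateField ℚ ℂ := algebraicClosure ℚ ℂ

instance QBar.instIsAlgClosure : IsAlgClosure ℚ QBar :=
  algebraicClosure.isAlgClosure ℚ ℂ

instance QBar.instNormal : Normal ℚ QBar := IsAlgClosure.normal ℚ QBar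

instance QBar.instIsGalois : IsGalois ℚ QBar where

/-- Complex conjugation on the algebraic numbers. -/
noncomputable def conjBar : Gal(QBar/ℚ) :=
  (Complex.conjAe.restrictScalars ℚ).restrictNormal QBar

theorem coe_conjBar (x : QBar) : ((conjBar x : QBar) : ℂ) = (starRingEnd ℂ) (x : ℂ) :=
  AlgEquiv.restrictNormal_commutes (Complex.conjAe.restrictScalars ℚ) QBar x

theorem QBar.exists_int_of_fixed {x : QBar} (hx : IsIntegral ℤ x)
    (hfix : ∀ γ : Gal(QBar/ℚ), γ x = x) : ∃ z : ℤ, x = z := by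
  obtain ⟨q, rfl⟩ := (InfiniteGalois.mem_range_algebraMap_iff_fixed x).mpr hfix
  have hq : IsIntegral ℤ q :=
    (isIntegral_algebraMap_iff (algebraMap ℚ QBar).injective).mp hx
  obtain ⟨z, rfl⟩ := IsIntegrallyClosed.isIntegral_iff.mp hq
  exact ⟨z, by simp⟩

/-- The vectors of algebraic integers whose entries are permuted by the Galois group according
to `ρ`. -/
def equivariantIntegers {n : ℕ} (ρ : Gal(QBar/ℚ) → Fin n → Fin n) :
    AddSubgroup (Fin n → QBar) where
  carrier := {x | (∀ i, IsIntegral ℤ (x i)) ∧ ∀ γ i, x (ρ γ i) = γ (x i)}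
  zero_mem' := ⟨fun _ => isIntegral_zero, fun γ _ => by simp⟩
  add_mem' := fun ha hb => ⟨fun i => (ha.1 i).add (hb.1 i), fun γ i => by
    simp [ha.2 γ i, hb.2 γ i]⟩
  neg_mem' := fun ha => ⟨fun i => (ha.1 i).neg, fun γ i => by simp [ha.2 γ i]⟩

/-- The properties of the action of the Galois group on a set of `n` transitively permuted
objects. -/
structure IsTransitiveAction {n : ℕ} (ρ : Gal(QBar/ℚ) → Fin n → Fin n) : Prop where
  bijective : ∀ γ, Function.Bijective (ρ γ)
  transitive : ∀ i j, ∃ γ, ρ γ i = j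
  involutive : Function.Involutive (ρ conjBar)

section Basic

variable {n : ℕ} {ρ : Gal(QBar/ℚ) → Fin n → Fin n}

/-- The product is Galois invariant, hence a rational integer; by transitivity one nonzero entry
makes all entries nonzero. -/
theorem one_le_prod_norm (hρ : IsTransitiveAction ρ) {x : Fin n → QBar}
    (hx : x ∈ equivariantIntegers ρ) (h0 : x ≠ 0) : 1 ≤ ∏ i, ‖x i‖ := by
  have hne : ∀ j, x j ≠ 0 := by
    obtain ⟨i, hi⟩ := Function.ne_iff.mp h0
    intro j
    obtain ⟨γ, rfl⟩ := hρ.transitive i j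
    rw [hx.2]
    simpa using hi
  obtain ⟨z, hz⟩ := QBar.exists_int_of_fixed (x := ∏ i, x i)
    (IsIntegral.prod _ fun i _ => hx.1 i) (by
      intro γ
      rw [map_prod, ← (hρ.bijective γ).prod_comp x]
      exact Finset.prod_congr rfl fun i _ => (hx.2 γ i).symm)
  have hz0 : z ≠ 0 := by
    rintro rfl
    exact Finset.prod_ne_zero_iff.mpr (fun i _ => hne i) (hz.trans (by simp))
  rw [← norm_prod, hz]
  have : ‖((z : QBar) : QBar)‖ = |(z : ℝ)| := by
    change ‖((z : QBar) : ℂ)‖ = _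
    simp
  rw [this]
  exact_mod_cast Int.one_le_abs hz0

theorem eq_of_injective_mem {ρ' : Gal(QBar/ℚ) → Fin n → Fin n} {x : Fin n → QBar}
    (hx : x ∈ equivariantIntegers ρ) (hx' : x ∈ equivariantIntegers ρ')
    (hinj : Function.Injective x) : ρ = ρ' := by
  ext γ i : 2
  exact hinj ((hx.2 γ i).trans (hx'.2 γ i).symm)

theorem coe_apply_conjBar {x : Fin n → QBar} (hx : x ∈ equivariantIntegers ρ) (i : Fin n) :
    ((x (ρ conjBar i) : QBar) : ℂ) = (starRingEnd ℂ) (x i : ℂ) := by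
  rw [hx.2, coe_conjBar]

theorem norm_apply_conjBar {x : Fin n → QBar} (hx : x ∈ equivariantIntegers ρ) (i : Fin n) :
    ‖x (ρ conjBar i)‖ = ‖x i‖ := by
  change ‖((x (ρ conjBar i) : QBar) : ℂ)‖ = ‖(x i : ℂ)‖
  rw [coe_apply_conjBar hx, RCLike.norm_conj]

/-- Real coordinates of an equivariant vector, where `c` is the action of complex conjugation. -/
noncomputable def realCoord (c : Fin n → Fin n) (x : Fin n → QBar) (i : Fin n) : ℝ :=
  if i ≤ c i then (x i : ℂ).re else (x i : ℂ).im

theorem realCoord_sub (c : Fin n → Fin n) (x y : Fin n → QBar) (i : Fin n) :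
    realCoord c (x - y) i = realCoord c x i - realCoord c y i := by
  unfold realCoord
  split_ifs <;> simp

theorem abs_realCoord_le (c : Fin n → Fin n) (x : Fin n → QBar) (i : Fin n) :
    |realCoord c x i| ≤ ‖x i‖ := by
  unfold realCoord
  split_ifs
  · exact Complex.abs_re_le_norm _
  · exact Complex.abs_im_le_norm _

/-- Of two conjugate indices the smaller carries the real part and the larger the imaginary part, up
to sign. At a fixed index the entry is real. -/
theorem norm_le_abs_realCoord (hρ : IsTransitiveAction ρ) {x : Fin n → QBar}
    (hx : x ∈ equivariantIntegers ρ) (i : Fin n) :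
    ‖x i‖ ≤ |realCoord (ρ conjBar) x i| + |realCoord (ρ conjBar) x (ρ conjBar i)| := by
  have h1 : ‖x i‖ ≤ |(x i : ℂ).re| + |(x i : ℂ).im| := Complex.norm_le_abs_re_add_abs_im _
  have h2 := coe_apply_conjBar hx i
  have h3 := hρ.involutive i
  unfold realCoord
  rw [h3, h2]
  rcases lt_trichotomy i (ρ conjBar i) with h | h | h
  · simpa [h.le, h.not_ge] using h1
  · rw [← h] at h2 ⊢
    have h4 : (x i : ℂ).im = 0 := Complex.conj_eq_iff_im.mp h2.symm
    simp only [le_refl, if_true, Complex.conj_re]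
    rw [h4] at h1
    linarith [abs_nonneg (x i : ℂ).re, abs_zero (α := ℝ)]
  · simp only [h.le, h.not_ge, if_true, if_false, Complex.conj_re]
    linarith

/-- The equivariant vectors of algebraic integers bounded by `M`. -/
def boundedIntegers (ρ : Gal(QBar/ℚ) → Fin n → Fin n) (M : Fin n → ℝ) : Set (Fin n → QBar) :=
  {x | x ∈ equivariantIntegers ρ ∧ ∀ i, ‖x i‖ ≤ M i}

/-- The bounded equivariant vectors of algebraic integers with distinct entries. -/
def boundedGenerators (ρ : Gal(QBar/ℚ) → Fin n → Fin n) (M : Fin n → ℝ) : Set (Fin n → QBar) :=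
  {x | x ∈ boundedIntegers ρ M ∧ Function.Injective x}

end Basic

/-! ### Geometry of numbers in a box -/

section Box

variable {n : ℕ} {ρ : Gal(QBar/ℚ) → Fin n → Fin n} {R : Fin n → ℝ} {q : ℝ}

/-- Otherwise the product of the norms would be at most (2/3)^n < 1. -/
theorem eq_zero_of_norm_le (hρ : IsTransitiveAction ρ) (hn : 0 < n)
    (hq : 1 ≤ q) (hqR : q ^ n = ∏ i, R i) {z : Fin n → QBar} (hz : z ∈ equivariantIntegers ρ)
    (h : ∀ i, ‖z i‖ ≤ 2 * (R i / (3 * q))) : z = 0 := by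
  by_contra h0
  have h1 := one_le_prod_norm hρ hz h0
  have h2 : ∏ i, ‖z i‖ ≤ ∏ i, (2 / 3 * q⁻¹) * R i :=
    Finset.prod_le_prod (fun _ _ => norm_nonneg _) fun i _ =>
      (h i).trans_eq (by field_simp)
  rw [Finset.prod_mul_distrib, Finset.prod_const, ← hqR, Finset.card_univ, Fintype.card_fin,
    ← mul_pow] at h2
  have h3 : 2 / 3 * q⁻¹ * q = 2 / 3 := by field_simp
  rw [h3] at h2
  have h4 : (2 / 3 : ℝ) ^ n < 1 := pow_lt_one₀ (by norm_num) (by norm_num) hn.ne'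
  linarith

/-- If every equivariant vector whose coordinates in `J` are small is small, then at most
`(12 q) ^ #J` vectors satisfy the bounds. -/
theorem card_le_pow_of_coords (hρ : IsTransitiveAction ρ) (hn : 0 < n) (hR : ∀ i, 1 ≤ R i)
    (hq : 1 ≤ q) (hqR : q ^ n = ∏ i, R i) (J : Finset (Fin n)) (p : (Fin n → QBar) → Prop)
    (hp : ∀ x y, p x → p y → p (x - y))
    (hJ : ∀ z ∈ equivariantIntegers ρ, p z →
      (∀ i ∈ J, |realCoord (ρ conjBar) z i| < R i / (3 * q)) → ∀ i, ‖z i‖ ≤ 2 * (R i / (3 * q)))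
    (F : Finset (Fin n → QBar)) (hF : ∀ x ∈ F, x ∈ boundedIntegers ρ R ∧ p x) :
    (F.card : ℝ) ≤ (12 * q) ^ J.card := by
  have hδ : ∀ i, 0 < R i / (3 * q) := fun i => by
    have := hR i
    positivity
  have key := Finset.card_le_mul_prod_of_card_cell_le F J (realCoord (ρ conjBar)) R
    (fun i => R i / (3 * q)) 1 (fun i _ => hδ i)
    (fun i _ => div_le_self (by linarith [hR i]) (by linarith))
    (fun x hx i _ => (abs_realCoord_le _ _ _).trans ((hF x hx).1.2 i)) (by
      intro G hG hclose
      suffices G.card ≤ 1 by exact_mod_cast this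
      rw [Finset.card_le_one]
      intro x hx y hy
      have hx' := hF x (hG hx)
      have hy' := hF y (hG hy)
      have hz : x - y ∈ equivariantIntegers ρ := sub_mem hx'.1.1 hy'.1.1
      refine sub_eq_zero.mp (eq_zero_of_norm_le hρ hn hq hqR hz
        (hJ _ hz (hp x y hx'.2 hy'.2) fun i hi => ?_))
      rw [realCoord_sub]
      exact hclose x hx y hy i hi)
  have hfac : ∀ i ∈ J, 4 * (R i / (R i / (3 * q))) = 12 * q := by
    intro i _
    have := hR i
    field_simp
    norm_num
  rwa [Finset.prod_congr rfl hfac, Finset.prod_const, one_mul] at key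

theorem boundedIntegers_finite_and_ncard_le (hρ : IsTransitiveAction ρ) (hn : 0 < n)
    (hR : ∀ i, 1 ≤ R i) (hRc : ∀ i, R (ρ conjBar i) = R i)
    (hq : 1 ≤ q) (hqR : q ^ n = ∏ i, R i) :
    (boundedIntegers ρ R).Finite ∧ ((boundedIntegers ρ R).ncard : ℝ) ≤ (12 * q) ^ n := by
  refine Set.finite_and_ncard_le_of_forall_finset fun F hF => ?_
  have := card_le_pow_of_coords hρ hn hR hq hqR Finset.univ (fun _ => True)
    (fun _ _ _ _ => trivial) (by
      intro z hz _ h i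
      have h1 := h i (Finset.mem_univ _)
      have h2 := h (ρ conjBar i) (Finset.mem_univ _)
      rw [hRc] at h2
      linarith [norm_le_abs_realCoord hρ hz i]) F fun x hx => ⟨hF hx, trivial⟩
  simpa using this

/-- A coincidence of two entries makes one real coordinate redundant, which saves a factor `12 * q`
over the count of all vectors. -/
theorem card_le_of_eq_coords (hρ : IsTransitiveAction ρ) (hn : 0 < n)
    (hR : ∀ i, 1 ≤ R i) (hRc : ∀ i, R (ρ conjBar i) = R i)
    (hq : 1 ≤ q) (hqR : q ^ n = ∏ i, R i) {a b : Fin n} (hab : a ≠ b)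
    (F : Finset (Fin n → QBar)) (hF : ∀ x ∈ F, x ∈ boundedIntegers ρ R ∧ x a = x b) :
    (F.card : ℝ) ≤ (12 * q) ^ (n - 1) := by
  -- The coordinate at `a` will be dropped. If `a` and `b` are not conjugate, the entry at `b` still
  -- has both its coordinates, and `R b ≤ R a` makes its bound good enough for `a`. If they are
  -- conjugate, the common entry is real, and `b < a` ensures that the coordinate kept at `b` is the
  -- real part.
  wlog H : (ρ conjBar b ≠ a ∧ R b ≤ R a) ∨ (ρ conjBar b = a ∧ b < a) generalizing a b
  · refine this hab.symm (fun x hx => ⟨(hF x hx).1, (hF x hx).2.symm⟩) ?_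
    by_cases hc : ρ conjBar b = a
    · right
      have h1 : ρ conjBar a = b := by rw [← hc]; exact hρ.involutive b
      exact ⟨h1, lt_of_le_of_ne (not_lt.mp fun h => H (Or.inr ⟨hc, h⟩)) hab⟩
    · left
      refine ⟨fun h1 => hc (by rw [← h1]; exact hρ.involutive a), ?_⟩
      exact (not_le.mp fun h => H (Or.inl ⟨hc, h⟩)).le
  have := card_le_pow_of_coords hρ hn hR hq hqR (Finset.univ.erase a) (fun x => x a = x b)
    (fun x y hx hy => by simp [hx, hy]) (by
      intro z hz hzab h
      have hδ : ∀ i, 0 < R i / (3 * q) := fun i => by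
        have := hR i
        positivity
      have h' : ∀ i, i ≠ a → |realCoord (ρ conjBar) z i| < R i / (3 * q) := fun i hi =>
        h i (by simpa using hi)
      have hza : ‖z a‖ ≤ 2 * (R a / (3 * q)) := by
        rw [hzab]
        rcases H with ⟨hc, hle⟩ | ⟨hc, hlt⟩
        · have h1 := h' b hab.symm
          have h2 := h' _ hc
          rw [hRc] at h2
          have h3 : R b / (3 * q) ≤ R a / (3 * q) := by gcongr
          linarith [norm_le_abs_realCoord hρ hz b]
        · have h1 := h' b hab.symm
          have h2 : (starRingEnd ℂ) (z b : ℂ) = (z b : ℂ) := by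
            rw [← coe_apply_conjBar hz, hc, hzab]
          have h3 : realCoord (ρ conjBar) z b = (z b : ℂ).re := by
            rw [realCoord, if_pos (hc ▸ hlt.le)]
          have h4 : ‖z b‖ = |(z b : ℂ).re| := by
            change ‖(z b : ℂ)‖ = _
            conv_lhs => rw [← Complex.conj_eq_iff_re.mp h2]
            simp
          have h5 : R b = R a := by rw [← hc, hRc]
          rw [h3, ← h4, h5] at h1
          linarith [hδ a]
      intro i
      by_cases hi : i = a
      · rwa [hi]
      · by_cases hci : ρ conjBar i = a
        · rw [← norm_apply_conjBar hz, ← hRc i, hci]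
          exact hza
        · have h1 := h' i hi
          have h2 := h' _ hci
          rw [hRc] at h2
          linarith [norm_le_abs_realCoord hρ hz i]) F hF
  simpa using this

theorem ncard_boundedIntegers_le_add (hρ : IsTransitiveAction ρ) (hn : 0 < n)
    (hR : ∀ i, 1 ≤ R i) (hRc : ∀ i, R (ρ conjBar i) = R i)
    (hq : 1 ≤ q) (hqR : q ^ n = ∏ i, R i) :
    ((boundedIntegers ρ R).ncard : ℝ) ≤
      (boundedGenerators ρ R).ncard + (n : ℝ) ^ 2 * (12 * q) ^ (n - 1) := by
  classical
  have hfin := (boundedIntegers_finite_and_ncard_le hρ hn hR hRc hq hqR).1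
  have hsub : boundedGenerators ρ R ⊆ boundedIntegers ρ R := fun x hx => hx.1
  have h1 : ((boundedIntegers ρ R \ boundedGenerators ρ R).ncard : ℝ) ≤
      (n : ℝ) ^ 2 * (12 * q) ^ (n - 1) := by
    refine (Set.finite_and_ncard_le_of_forall_finset fun F hF => ?_).2
    have hcover : F ⊆ (Finset.univ.filter fun p : Fin n × Fin n => p.1 ≠ p.2).biUnion
        fun p => F.filter fun x => x p.1 = x p.2 := by
      intro x hx
      have h2 : ¬ Function.Injective x := fun h => (hF hx).2 ⟨(hF hx).1, h⟩
      rw [Function.Injective] at h2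
      push Not at h2
      obtain ⟨a, b, h3, h4⟩ := h2
      simp only [Finset.mem_biUnion, Finset.mem_filter, Finset.mem_univ, true_and]
      exact ⟨(a, b), h4, hx, h3⟩
    calc (F.card : ℝ) ≤ ∑ p ∈ Finset.univ.filter fun p : Fin n × Fin n => p.1 ≠ p.2,
          ((F.filter fun x => x p.1 = x p.2).card : ℝ) := by
          exact_mod_cast (Finset.card_le_card hcover).trans Finset.card_biUnion_le
      _ ≤ ∑ p ∈ Finset.univ.filter fun p : Fin n × Fin n => p.1 ≠ p.2, (12 * q) ^ (n - 1) := by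
          refine Finset.sum_le_sum fun p hp => ?_
          refine card_le_of_eq_coords hρ hn hR hRc hq hqR (Finset.mem_filter.mp hp).2 _ ?_
          intro x hx
          exact ⟨(hF (Finset.mem_filter.mp hx).1).1, (Finset.mem_filter.mp hx).2⟩
      _ ≤ _ := by
          rw [Finset.sum_const, nsmul_eq_mul]
          gcongr
          have := Finset.card_filter_le (Finset.univ : Finset (Fin n × Fin n))
            fun p => p.1 ≠ p.2
          rw [Finset.card_univ, Fintype.card_prod, Fintype.card_fin, ← pow_two] at this
          exact_mod_cast this
  have h2 := Set.ncard_sdiff_add_ncard_of_subset hsub hfin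
  have h3 : ((boundedIntegers ρ R).ncard : ℝ) = (boundedIntegers ρ R \ boundedGenerators ρ R).ncard
      + (boundedGenerators ρ R).ncard := by exact_mod_cast h2.symm
  linarith

/-- Pigeonhole: cut the large box into cells of sides `R i / 2`. Subtracting a fixed point of a cell
maps its points injectively into the box `R`, a norm being at most the sum of two coordinates. -/
theorem ncard_boundedIntegers_le_mul (hρ : IsTransitiveAction ρ) (hn : 0 < n)
    {M : Fin n → ℝ} (hR : ∀ i, 1 ≤ R i) (hRM : ∀ i, R i ≤ M i)
    (hRc : ∀ i, R (ρ conjBar i) = R i) (hq : 1 ≤ q) (hqR : q ^ n = ∏ i, R i) :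
    ((boundedIntegers ρ M).ncard : ℝ) ≤
      8 ^ n * ((∏ i, M i) / ∏ i, R i) * (boundedIntegers ρ R).ncard := by
  have hfin := (boundedIntegers_finite_and_ncard_le hρ hn hR hRc hq hqR).1
  refine (Set.finite_and_ncard_le_of_forall_finset fun F hF => ?_).2
  have hpos : ∀ i, 0 < R i := fun i => by linarith [hR i]
  have key := Finset.card_le_mul_prod_of_card_cell_le F Finset.univ (realCoord (ρ conjBar)) M
    (fun i => R i / 2) (boundedIntegers ρ R).ncard (fun i _ => by linarith [hpos i])
    (fun i _ => by linarith [hpos i, hRM i])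
    (fun x hx i _ => (abs_realCoord_le _ _ _).trans ((hF hx).2 i)) (by
      intro G hG hclose
      rcases G.eq_empty_or_nonempty with rfl | ⟨x₀, hx₀⟩
      · simp
      have : G.card ≤ (boundedIntegers ρ R).ncard := by
        rw [← Set.ncard_coe_finset]
        refine Set.ncard_le_ncard_of_injOn (fun x => x - x₀) ?_ ?_ hfin
        · intro x hx
          have hz : x - x₀ ∈ equivariantIntegers ρ := sub_mem (hF (hG hx)).1 (hF (hG hx₀)).1
          refine ⟨hz, fun i => ?_⟩
          have h1 := hclose x hx x₀ hx₀ i (Finset.mem_univ _)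
          have h2 := hclose x hx x₀ hx₀ (ρ conjBar i) (Finset.mem_univ _)
          rw [← realCoord_sub] at h1 h2
          rw [hRc] at h2
          exact (norm_le_abs_realCoord hρ hz i).trans (by linarith)
        · intro x _ y _ h
          exact sub_left_injective h
      exact_mod_cast this)
  refine key.trans_eq ?_
  have hfac : ∀ i, 4 * (M i / (R i / 2)) = 8 * (M i / R i) := by
    intro i
    have := hpos i
    field_simp
    ring
  simp only [hfac]
  rw [Finset.prod_mul_distrib, Finset.prod_const, Finset.prod_div_distrib, Finset.card_univ,
    Fintype.card_fin]
  ring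

end Box

/-! ### Counting generators by their characteristic polynomials -/

theorem Polynomial.mahlerMeasure_finset_prod {ι : Type*} (s : Finset ι) (f : ι → ℂ[X]) :
    (∏ i ∈ s, f i).mahlerMeasure = ∏ i ∈ s, (f i).mahlerMeasure := by
  rw [Finset.prod, prod_mahlerMeasure_eq_mahlerMeasure_prod, Multiset.map_map]
  rfl

theorem Polynomial.norm_coeff_prod_X_sub_C_le {ι : Type*} (s : Finset ι) (z : ι → ℂ) (k : ℕ) :
    ‖(∏ i ∈ s, (X - C (z i))).coeff k‖ ≤ 2 ^ s.card * ∏ i ∈ s, max 1 ‖z i‖ := by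
  have h := norm_coeff_le_choose_mul_mahlerMeasure k (∏ i ∈ s, (X - C (z i)))
  simp only [mahlerMeasure_finset_prod, mahlerMeasure_X_sub_C,
    natDegree_finsetProd_X_sub_C_eq_card] at h
  refine h.trans ?_
  gcongr
  exact_mod_cast Nat.choose_le_two_pow _ _

theorem isIntegral_coeff_prod_X_sub_C {ι : Type*} (s : Finset ι) (z : ι → QBar)
    (hz : ∀ i ∈ s, IsIntegral ℤ (z i)) (k : ℕ) :
    IsIntegral ℤ ((∏ i ∈ s, (X - C (z i))).coeff k) := by
  classical
  induction s using Finset.induction_on generalizing k with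
  | empty =>
    rw [Finset.prod_empty, coeff_one]
    split_ifs
    exacts [isIntegral_one, isIntegral_zero]
  | insert i s hi ih =>
    rw [Finset.prod_insert hi, coeff_mul]
    refine IsIntegral.sum _ fun p _ => IsIntegral.mul ?_
      (ih (fun j hj => hz j (Finset.mem_insert_of_mem hj)) _)
    rw [coeff_sub, coeff_X, coeff_C]
    refine IsIntegral.sub ?_ ?_ <;> split_ifs
    exacts [isIntegral_one, isIntegral_zero, hz i (Finset.mem_insert_self _ _), isIntegral_zero]

section Generators

variable {n : ℕ}

theorem exists_int_coeff {ρ : Gal(QBar/ℚ) → Fin n → Fin n} (hρ : IsTransitiveAction ρ)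
    {x : Fin n → QBar} (hx : x ∈ equivariantIntegers ρ) (k : ℕ) :
    ∃ a : ℤ, (∏ i, (X - C (x i)) : Polynomial QBar).coeff k = (a : QBar) := by
  refine QBar.exists_int_of_fixed (isIntegral_coeff_prod_X_sub_C _ _ (fun i _ => hx.1 i) k) ?_
  intro γ
  have h : (∏ i, (X - C (x i))).map (γ : QBar →+* QBar) = ∏ i, (X - C (x i)) := by
    rw [Polynomial.map_prod, ← (hρ.bijective γ).prod_comp fun i => X - C (x i)]
    refine Finset.prod_congr rfl fun i _ => ?_
    rw [hx.2 γ i]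
    simp
  conv_rhs => rw [← h, coeff_map]
  rfl

/-- The polynomial with roots `x i` has integral coefficients bounded by `2 ^ n * ∏ i, M i`, and at
most `n ^ n` vectors have all their entries among the roots of one polynomial. The action may vary
with `x`. -/
theorem card_le_of_generators {M : Fin n → ℝ} (hM : ∀ i, 1 ≤ M i) (F : Finset (Fin n → QBar))
    (hF : ∀ x ∈ F, ∃ ρ, IsTransitiveAction ρ ∧ x ∈ boundedIntegers ρ M) :
    (F.card : ℝ) ≤ n ^ n * (4 * (2 ^ n * ∏ i, M i)) ^ n := by
  classical
  have hcoeff : ∀ x : Fin n → QBar, ∃ a : Fin n → ℤ, x ∈ F →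
      ∀ k : Fin n, (∏ i, (X - C (x i)) : Polynomial QBar).coeff k = (a k : QBar) := by
    intro x
    by_cases hx : x ∈ F
    · obtain ⟨ρ, hρ, hxρ⟩ := hF x hx
      choose a ha using exists_int_coeff hρ hxρ.1
      exact ⟨fun k => a k, fun _ k => ha k⟩
    · exact ⟨0, fun h => absurd h hx⟩
  choose a ha using hcoeff
  set B : ℝ := 2 ^ n * ∏ i, M i with hB
  have hB1 : 1 ≤ B := by
    have h1 : (1 : ℝ) ≤ ∏ i, M i := by
      simpa using Finset.prod_le_prod (s := Finset.univ) (f := fun _ : Fin n => (1 : ℝ))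
        (fun _ _ => zero_le_one) fun i _ => hM i
    have h2 : (1 : ℝ) ≤ 2 ^ n := one_le_pow₀ (by norm_num)
    nlinarith
  let T : Finset (Fin n → ℤ) := Fintype.piFinset fun _ => Finset.Icc ⌊-B⌋ ⌊B⌋
  have hmaps : ∀ x ∈ F, a x ∈ T := by
    intro x hx
    rw [Fintype.mem_piFinset]
    intro k
    obtain ⟨ρ, hρ, hxρ⟩ := hF x hx
    have h1 := norm_coeff_prod_X_sub_C_le Finset.univ (fun i => (x i : ℂ)) k
    have h2 : (∏ i, (X - C (x i : ℂ))) = (∏ i, (X - C (x i))).map (algebraMap QBar ℂ) := by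
      rw [Polynomial.map_prod]
      exact Finset.prod_congr rfl fun i _ => by simp
    rw [h2, coeff_map, ha x hx k] at h1
    have h3 : |(a x k : ℝ)| ≤ B := by
      have h4 : ∏ i, max 1 ‖(x i : ℂ)‖ ≤ ∏ i, M i :=
        Finset.prod_le_prod (fun _ _ => by positivity) fun i _ => max_le (hM i) (hxρ.2 i)
      have h5 : ‖algebraMap QBar ℂ (a x k : QBar)‖ = |(a x k : ℝ)| := by simp
      rw [h5, Finset.card_univ, Fintype.card_fin] at h1
      exact h1.trans (by rw [hB]; gcongr)
    rw [Finset.mem_Icc]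
    have h6 := abs_le.mp h3
    constructor
    · rw [← Int.floor_intCast (R := ℝ) (a x k)]
      exact Int.floor_le_floor h6.1
    · exact Int.le_floor.mpr h6.2
  have hfiber : ∀ t ∈ T, (F.filter fun x => a x = t).card ≤ n ^ n := by
    intro t _
    rcases (F.filter fun x => a x = t).eq_empty_or_nonempty with h | ⟨y, hy⟩
    · rw [h]
      simp
    rw [Finset.mem_filter] at hy
    have hsub : (F.filter fun x => a x = t) ⊆
        Fintype.piFinset fun _ => Finset.univ.image y := by
      intro x hx
      rw [Finset.mem_filter] at hx
      have hpoly : (∏ i, (X - C (x i))) = ∏ i, (X - C (y i)) := by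
        have hdeg : ∀ w : Fin n → QBar, (∏ i, (X - C (w i))).natDegree = n := fun w => by
          simp [natDegree_finsetProd_X_sub_C_eq_card]
        have hmon : ∀ w : Fin n → QBar, (∏ i, (X - C (w i))).Monic := fun w =>
          monic_prod_X_sub_C _ _
        ext1 k
        rcases lt_trichotomy k n with hk | hk | hk
        · rw [ha x hx.1 ⟨k, hk⟩, ha y hy.1 ⟨k, hk⟩, hx.2, hy.2]
        · have h1 := (hmon x).coeff_natDegree
          have h2 := (hmon y).coeff_natDegree
          rw [hdeg] at h1 h2
          rw [hk, h1, h2]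
        · rw [coeff_eq_zero_of_natDegree_lt (by rwa [hdeg]),
            coeff_eq_zero_of_natDegree_lt (by rwa [hdeg])]
      rw [Fintype.mem_piFinset]
      intro i
      have h1 : (∏ j, (X - C (y j))).eval (x i) = 0 := by
        rw [← hpoly, eval_prod]
        exact Finset.prod_eq_zero (Finset.mem_univ i) (by simp)
      rw [eval_prod, Finset.prod_eq_zero_iff] at h1
      obtain ⟨j, _, hj⟩ := h1
      rw [eval_sub, eval_X, eval_C, sub_eq_zero] at hj
      rw [Finset.mem_image]
      exact ⟨j, Finset.mem_univ _, hj.symm⟩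
    refine (Finset.card_le_card hsub).trans ?_
    rw [Fintype.card_piFinset_const]
    gcongr
    exact Finset.card_image_le.trans (by simp)
  have h1 := Finset.card_le_mul_card_image_of_maps_to hmaps (n ^ n) hfiber
  have h2 : (T.card : ℝ) ≤ (4 * B) ^ n := by
    rw [Fintype.card_piFinset_const, Nat.cast_pow]
    gcongr
    exact Int.card_Icc_floor_le hB1
  calc (F.card : ℝ) ≤ n ^ n * T.card := by exact_mod_cast h1
    _ ≤ _ := by gcongr

/-- Generators belonging to different actions are different, so that the total number of bounded
generators is bounded. -/
theorem sum_ncard_boundedGenerators_le {M : Fin n → ℝ} (hM : ∀ i, 1 ≤ M i)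
    (𝓡 : Finset (Gal(QBar/ℚ) → Fin n → Fin n)) (h𝓡 : ∀ ρ ∈ 𝓡, IsTransitiveAction ρ)
    (hfin : ∀ ρ ∈ 𝓡, (boundedGenerators ρ M).Finite) :
    ∑ ρ ∈ 𝓡, ((boundedGenerators ρ M).ncard : ℝ) ≤ n ^ n * (4 * (2 ^ n * ∏ i, M i)) ^ n := by
  classical
  let G : (Gal(QBar/ℚ) → Fin n → Fin n) → Finset (Fin n → QBar) := fun ρ =>
    if h : (boundedGenerators ρ M).Finite then h.toFinset else ∅
  have hG : ∀ ρ ∈ 𝓡, ∀ x, x ∈ G ρ ↔ x ∈ boundedGenerators ρ M := fun ρ hρ x => by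
    simp [G, hfin ρ hρ]
  have hcard : ∀ ρ ∈ 𝓡, ((boundedGenerators ρ M).ncard : ℝ) = (G ρ).card := fun ρ hρ => by
    rw [Set.ncard_eq_toFinset_card _ (hfin ρ hρ)]
    simp [G, hfin ρ hρ]
  rw [Finset.sum_congr rfl hcard, ← Nat.cast_sum, ← Finset.card_biUnion]
  · refine card_le_of_generators hM _ fun x hx => ?_
    obtain ⟨ρ, hρ, hx⟩ := Finset.mem_biUnion.mp hx
    exact ⟨ρ, h𝓡 ρ hρ, ((hG ρ hρ x).mp hx).1⟩
  · intro ρ hρ ρ' hρ' hne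
    refine Finset.disjoint_left.mpr fun x hx hx' => hne ?_
    rw [hG ρ hρ] at hx
    rw [hG ρ' hρ'] at hx'
    exact eq_of_injective_mem hx.1.1 hx'.1.1 hx.2

end Generators

/-! ### The main counting estimate -/

section MainCount

variable {n : ℕ} {M : Fin n → ℝ}

/-- Few actions admit at least `N` vectors bounded by `M`, when `N` is close to `∏ M`: here
`q` measures the quotient `(∏ M) / N`. -/
theorem card_mul_le_of_le_ncard (hn : 0 < n) (hM : ∀ i, 1 ≤ M i)
    (𝓡 : Finset (Gal(QBar/ℚ) → Fin n → Fin n)) (h𝓡 : ∀ ρ ∈ 𝓡, IsTransitiveAction ρ)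
    (h𝓡c : ∀ ρ ∈ 𝓡, ∀ i, M (ρ conjBar i) = M i) {N q : ℝ}
    (hN : ∀ ρ ∈ 𝓡, N ≤ (boundedIntegers ρ M).ncard)
    (hNq : N * q = 2 * n ^ 2 * 96 ^ n * ∏ i, M i) (hq : 1 ≤ q) (hqP : q ^ n ≤ ∏ i, M i) :
    𝓡.card * N ≤ 2 * 8 ^ n * n ^ n * (4 * 2 ^ n) ^ n * (∏ i, M i) * q ^ (n * (n - 1)) := by
  set P : ℝ := ∏ i, M i with hP
  have hqn : 1 ≤ q ^ n := one_le_pow₀ hq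
  have hP1 : 1 ≤ P := hqn.trans hqP
  -- The exponent solves `P ^ θ = q ^ n`, so the box `M i ^ θ` has product `q ^ n` and sides between
  -- 1 and `M i`. If `P = 1`, division by zero gives `θ = 0`, which is still correct.
  set θ : ℝ := Real.log (q ^ n) / Real.log P with hθ
  have hθ0 : 0 ≤ θ := div_nonneg (Real.log_nonneg hqn) (Real.log_nonneg hP1)
  have hθ1 : θ ≤ 1 := div_le_one_of_le₀
    (Real.log_le_log (by positivity) hqP) (Real.log_nonneg hP1)
  have hPθ : P ^ θ = q ^ n := by
    rcases hP1.eq_or_lt with h | h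
    · have h1 : q ^ n = 1 := le_antisymm (h ▸ hqP) hqn
      rw [← h, h1, Real.one_rpow]
    · rw [Real.rpow_def_of_pos (by positivity), hθ, mul_div_cancel₀ _ (Real.log_pos h).ne',
        Real.exp_log (by positivity)]
  set R : Fin n → ℝ := fun i => M i ^ θ with hRdef
  have hR1 : ∀ i, 1 ≤ R i := fun i => Real.one_le_rpow (hM i) hθ0
  have hRM : ∀ i, R i ≤ M i := fun i =>
    (Real.rpow_le_rpow_of_exponent_le (hM i) hθ1).trans_eq (Real.rpow_one _)
  have hRprod : q ^ n = ∏ i, R i := by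
    rw [hRdef, Real.finsetProd_rpow _ _ fun i _ => zero_le_one.trans (hM i), ← hP, hPθ]
  have hRc : ∀ ρ ∈ 𝓡, ∀ i, R (ρ conjBar i) = R i := fun ρ hρ i => by
    simp only [hRdef, h𝓡c ρ hρ i]
  have hlow : ∀ ρ ∈ 𝓡, N * q ^ n ≤ 2 * 8 ^ n * P * (boundedGenerators ρ R).ncard := by
    intro ρ hρ
    have h1 := ncard_boundedIntegers_le_mul (h𝓡 ρ hρ) hn hR1 hRM (hRc ρ hρ) hq hRprod
    have h2 := ncard_boundedIntegers_le_add (h𝓡 ρ hρ) hn hR1 (hRc ρ hρ) hq hRprod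
    rw [← hRprod, ← hP] at h1
    set G : ℝ := ((boundedGenerators ρ R).ncard : ℝ)
    have h3 : N ≤ 8 ^ n * (P / q ^ n) * (G + n ^ 2 * (12 * q) ^ (n - 1)) :=
      (hN ρ hρ).trans (h1.trans (by gcongr))
    have h4 : N * q ^ n ≤ 8 ^ n * P * (G + n ^ 2 * (12 * q) ^ (n - 1)) := by
      calc N * q ^ n ≤ 8 ^ n * (P / q ^ n) * (G + n ^ 2 * (12 * q) ^ (n - 1)) * q ^ n := by
            gcongr
        _ = _ := by field_simp
    -- The constant in `hNq` is made for this: 96 = 8 · 12, and the factor 2 leaves at least half of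
    -- the lower bound to the generators.
    have h5 : 2 * (8 ^ n * P * (n ^ 2 * (12 * q) ^ (n - 1))) ≤ N * q ^ n := by
      obtain ⟨m, rfl⟩ : ∃ m, n = m + 1 := ⟨n - 1, by omega⟩
      have h6 : (12 : ℝ) ^ m ≤ 12 ^ (m + 1) := pow_le_pow_right₀ (by norm_num) (by omega)
      have h7 : (96 : ℝ) ^ (m + 1) = 8 ^ (m + 1) * 12 ^ (m + 1) := by
        rw [← mul_pow]
        norm_num
      calc 2 * (8 ^ (m + 1) * P * (((m + 1 : ℕ) : ℝ) ^ 2 * (12 * q) ^ (m + 1 - 1)))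
          = 2 * ((m + 1 : ℕ) : ℝ) ^ 2 * 8 ^ (m + 1) * P * q ^ m * 12 ^ m := by
            rw [Nat.add_sub_cancel, mul_pow]
            ring
        _ ≤ 2 * ((m + 1 : ℕ) : ℝ) ^ 2 * 8 ^ (m + 1) * P * q ^ m * 12 ^ (m + 1) := by gcongr
        _ = (2 * ((m + 1 : ℕ) : ℝ) ^ 2 * 96 ^ (m + 1) * P) * q ^ m := by
            rw [h7]
            ring
        _ = N * q ^ (m + 1) := by
            rw [← hNq]
            ring
    linarith
  have hfin : ∀ ρ ∈ 𝓡, (boundedGenerators ρ R).Finite := fun ρ hρ =>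
    (boundedIntegers_finite_and_ncard_le (h𝓡 ρ hρ) hn hR1 (hRc ρ hρ) hq hRprod).1.subset
      fun x hx => hx.1
  have hsum := sum_ncard_boundedGenerators_le hR1 𝓡 h𝓡 hfin
  rw [← hRprod] at hsum
  have h1 : 𝓡.card * (N * q ^ n) ≤
      2 * 8 ^ n * P * (n ^ n * (4 * (2 ^ n * q ^ n)) ^ n) := by
    calc 𝓡.card * (N * q ^ n) = ∑ ρ ∈ 𝓡, N * q ^ n := by rw [Finset.sum_const, nsmul_eq_mul]
      _ ≤ ∑ ρ ∈ 𝓡, 2 * 8 ^ n * P * (boundedGenerators ρ R).ncard := Finset.sum_le_sum hlow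
      _ = 2 * 8 ^ n * P * ∑ ρ ∈ 𝓡, ((boundedGenerators ρ R).ncard : ℝ) := by
          rw [Finset.mul_sum]
      _ ≤ _ := by gcongr
  have h2 : (q ^ n) ^ n = q ^ (n * (n - 1)) * q ^ n := by
    rw [← pow_mul, ← pow_add]
    congr 1
    obtain ⟨m, rfl⟩ : ∃ m, n = m + 1 := ⟨n - 1, by omega⟩
    simp
    ring
  have h3 : 2 * 8 ^ n * P * (n ^ n * (4 * (2 ^ n * q ^ n)) ^ n) =
      2 * 8 ^ n * n ^ n * (4 * 2 ^ n) ^ n * P * q ^ (n * (n - 1)) * q ^ n := by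
    rw [← mul_assoc 4, mul_pow (4 * 2 ^ n), h2]
    ring
  rw [h3, ← mul_assoc] at h1
  exact le_of_mul_le_mul_right h1 (by positivity)

/-- The exponent in the main counting estimate. -/
noncomputable def countExponent (n k : ℕ) : ℝ := max (k + 1) (n + (1 - 1 / n) * k)

/-- If the exponent n(n-1) - k of `q` is not positive, `q = 1` is the worst case; otherwise it is `q
= P ^ (1 / n)`. -/
theorem pow_mul_pow_div_le (hn : 0 < n) (k : ℕ) {P q : ℝ} (hq : 1 ≤ q) (hqP : q ^ n ≤ P) :
    P ^ (k + 1) * (q ^ (n * (n - 1)) / q ^ k) ≤ P ^ countExponent n k := by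
  have hP : 1 ≤ P := (one_le_pow₀ hq).trans hqP
  have hP0 : 0 < P := by linarith
  have hn' : (n : ℝ) ≠ 0 := by exact_mod_cast hn.ne'
  rcases le_or_gt (n * (n - 1)) k with h | h
  · calc P ^ (k + 1) * (q ^ (n * (n - 1)) / q ^ k) ≤ P ^ (k + 1) * 1 := by
          gcongr
          exact div_le_one_of_le₀ (pow_le_pow_right₀ hq h) (by positivity)
      _ = P ^ ((k + 1 : ℕ) : ℝ) := by rw [mul_one, Real.rpow_natCast]
      _ ≤ _ := by
          apply Real.rpow_le_rpow_of_exponent_le hP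
          push_cast
          exact le_max_left _ _
  · obtain ⟨d, hd⟩ := Nat.exists_eq_add_of_le h.le
    have hqd : q ^ (n * (n - 1)) / q ^ k = q ^ d := by
      rw [hd, pow_add]
      field_simp
    have h1 : q ^ d ≤ P ^ ((d : ℝ) / n) := by
      calc q ^ d = (q ^ n) ^ ((d : ℝ) / n) := by
            rw [← Real.rpow_natCast q n, ← Real.rpow_mul (by linarith),
              mul_div_cancel₀ _ hn', Real.rpow_natCast]
        _ ≤ _ := Real.rpow_le_rpow (by positivity) hqP (by positivity)
    have hdR : (n : ℝ) * (n - 1) = k + d := by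
      have : ((n * (n - 1) : ℕ) : ℝ) = k + d := by exact_mod_cast hd
      rwa [Nat.cast_mul, Nat.cast_sub hn, Nat.cast_one] at this
    calc P ^ (k + 1) * (q ^ (n * (n - 1)) / q ^ k)
        ≤ P ^ ((k + 1 : ℕ) : ℝ) * P ^ ((d : ℝ) / n) := by
          rw [hqd, Real.rpow_natCast]
          gcongr
      _ = P ^ (n + (1 - 1 / n) * k : ℝ) := by
          rw [← Real.rpow_add hP0]
          congr 1
          push_cast
          field_simp
          linarith
      _ ≤ _ := Real.rpow_le_rpow_of_exponent_le hP (le_max_right _ _)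

/-- Actions with few vectors are handled by the total number of generators, those with many by
counting actions in each dyadic class of the number of vectors. The logarithm counts the classes. -/
theorem sum_ncard_mul_pow_le (hn : 0 < n) (k : ℕ) : ∃ K : ℝ, 0 < K ∧
    ∀ M : Fin n → ℝ, (∀ i, 1 ≤ M i) → ∀ 𝓡 : Finset (Gal(QBar/ℚ) → Fin n → Fin n),
      (∀ ρ ∈ 𝓡, IsTransitiveAction ρ) → (∀ ρ ∈ 𝓡, ∀ i, M (ρ conjBar i) = M i) →
      ∑ ρ ∈ 𝓡, ((boundedGenerators ρ M).ncard : ℝ) * (boundedIntegers ρ M).ncard ^ k ≤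
        K * (∏ i, M i) ^ countExponent n k * (2 + Real.logb 2 (12 ^ n * ∏ i, M i)) := by
  classical
  set C₁ : ℝ := 2 * n ^ 2 * 96 ^ n with hC₁
  set C₂ : ℝ := 2 * 8 ^ n * n ^ n * (4 * 2 ^ n) ^ n with hC₂
  set C₃ : ℝ := n ^ n * (4 * 2 ^ n) ^ n with hC₃
  have hn0 : (0 : ℝ) < n := by exact_mod_cast hn
  have hC₁pos : 0 < C₁ := by positivity
  have hC₂pos : 0 < C₂ := by positivity
  have hC₃pos : 0 < C₃ := by positivity
  refine ⟨(2 * C₁) ^ k * C₃ + 2 ^ (k + 1) * C₁ ^ k * C₂, by positivity, ?_⟩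
  intro M hM 𝓡 h𝓡 h𝓡c
  set P : ℝ := ∏ i, M i with hPdef
  have hP : 1 ≤ P := by
    simpa using Finset.prod_le_prod (s := Finset.univ) (f := fun _ : Fin n => (1 : ℝ))
      (fun _ _ => zero_le_one) fun i _ => hM i
  have hP0 : 0 < P := by linarith
  set p : ℝ := P ^ (1 / (n : ℝ)) with hp
  have hp1 : 1 ≤ p := Real.one_le_rpow hP (by positivity)
  have hpn : p ^ n = P := by
    rw [hp, ← Real.rpow_natCast, ← Real.rpow_mul hP0.le, one_div_mul_cancel hn0.ne',
      Real.rpow_one]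
  have hpP : P ^ (1 - 1 / (n : ℝ)) * p = P := by
    rw [hp, ← Real.rpow_add hP0, sub_add_cancel, Real.rpow_one]
  let Nc : (Gal(QBar/ℚ) → Fin n → Fin n) → ℕ := fun ρ => (boundedIntegers ρ M).ncard
  let Gc : (Gal(QBar/ℚ) → Fin n → Fin n) → ℕ := fun ρ => (boundedGenerators ρ M).ncard
  have hfinN : ∀ ρ ∈ 𝓡, (boundedIntegers ρ M).Finite ∧ (Nc ρ : ℝ) ≤ (12 * p) ^ n :=
    fun ρ hρ => boundedIntegers_finite_and_ncard_le (h𝓡 ρ hρ) hn hM (h𝓡c ρ hρ) hp1 hpn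
  have hNle : ∀ ρ ∈ 𝓡, (Nc ρ : ℝ) ≤ 12 ^ n * P := fun ρ hρ => by
    have := (hfinN ρ hρ).2
    rwa [mul_pow, hpn] at this
  have hGN : ∀ ρ ∈ 𝓡, Gc ρ ≤ Nc ρ := fun ρ hρ =>
    Set.ncard_le_ncard (fun x hx => hx.1) (hfinN ρ hρ).1
  have hsumG : ∑ ρ ∈ 𝓡, (Gc ρ : ℝ) ≤ C₃ * P ^ n := by
    have h := sum_ncard_boundedGenerators_le hM 𝓡 h𝓡 fun ρ hρ =>
      (hfinN ρ hρ).1.subset fun x hx => hx.1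
    refine h.trans_eq ?_
    rw [hC₃, ← mul_assoc 4, mul_pow (4 * 2 ^ n), ← hPdef]
    ring
  set μ := countExponent n k with hμ
  set p' : ℝ := P ^ (1 - 1 / (n : ℝ)) with hp'
  have hp'pos : 0 < p' := by positivity
  have hlog : 0 ≤ Real.logb 2 (12 ^ n * P) := by
    apply Real.logb_nonneg (by norm_num)
    have : (1 : ℝ) ≤ 12 ^ n := one_le_pow₀ (by norm_num)
    nlinarith
  have hsmall : ∑ ρ ∈ 𝓡 with (Nc ρ : ℝ) ≤ 2 * C₁ * p', (Gc ρ : ℝ) * (Nc ρ : ℝ) ^ k ≤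
      (2 * C₁) ^ k * C₃ * P ^ μ := by
    calc ∑ ρ ∈ 𝓡 with (Nc ρ : ℝ) ≤ 2 * C₁ * p', (Gc ρ : ℝ) * (Nc ρ : ℝ) ^ k
        ≤ ∑ ρ ∈ 𝓡 with (Nc ρ : ℝ) ≤ 2 * C₁ * p', (Gc ρ : ℝ) * (2 * C₁ * p') ^ k := by
          refine Finset.sum_le_sum fun ρ hρ => ?_
          have := (Finset.mem_filter.mp hρ).2
          gcongr
      _ ≤ ∑ ρ ∈ 𝓡, (Gc ρ : ℝ) * (2 * C₁ * p') ^ k :=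
          Finset.sum_le_sum_of_subset_of_nonneg (Finset.filter_subset _ _)
            fun _ _ _ => by positivity
      _ = (∑ ρ ∈ 𝓡, (Gc ρ : ℝ)) * (2 * C₁ * p') ^ k := by rw [Finset.sum_mul]
      _ ≤ C₃ * P ^ n * (2 * C₁ * p') ^ k := by gcongr
      _ = (2 * C₁) ^ k * C₃ * (P ^ n * p' ^ k) := by
          rw [mul_pow]
          ring
      _ = (2 * C₁) ^ k * C₃ * P ^ (n + (1 - 1 / n) * k : ℝ) := by
          rw [hp', ← Real.rpow_natCast P n, ← Real.rpow_natCast (P ^ (1 - 1 / (n : ℝ))) k,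
            ← Real.rpow_mul hP0.le, ← Real.rpow_add hP0]
      _ ≤ _ := by
          gcongr
          exact le_max_right _ _
  set S : ℕ := Nat.log 2 ⌊12 ^ n * P⌋₊ with hS
  have hSlog : (S : ℝ) ≤ Real.logb 2 (12 ^ n * P) := by
    refine (Real.natLog_le_logb _ _).trans ?_
    have h12 : (1 : ℝ) ≤ 12 ^ n * P := by
      have : (1 : ℝ) ≤ 12 ^ n := one_le_pow₀ (by norm_num)
      nlinarith
    push_cast
    refine Real.logb_le_logb_of_le (by norm_num) ?_ (Nat.floor_le (by positivity))
    exact_mod_cast Nat.floor_pos.mpr h12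
  have hlarge : ∑ ρ ∈ 𝓡 with ¬ (Nc ρ : ℝ) ≤ 2 * C₁ * p', (Gc ρ : ℝ) * (Nc ρ : ℝ) ^ k ≤
      (S + 1) * (2 ^ (k + 1) * C₁ ^ k * C₂ * P ^ μ) := by
    have hmaps : ∀ ρ ∈ 𝓡.filter fun ρ => ¬ (Nc ρ : ℝ) ≤ 2 * C₁ * p',
        Nat.log 2 (Nc ρ) ∈ Finset.range (S + 1) := by
      intro ρ hρ
      rw [Finset.mem_range, Nat.lt_succ_iff]
      exact Nat.log_mono_right (Nat.le_floor (hNle ρ (Finset.mem_filter.mp hρ).1))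
    rw [← Finset.sum_fiberwise_of_maps_to hmaps]
    have hclass : ∀ s ∈ Finset.range (S + 1),
        ∑ ρ ∈ (𝓡.filter fun ρ => ¬ (Nc ρ : ℝ) ≤ 2 * C₁ * p') with Nat.log 2 (Nc ρ) = s,
          (Gc ρ : ℝ) * (Nc ρ : ℝ) ^ k ≤ 2 ^ (k + 1) * C₁ ^ k * C₂ * P ^ μ := by
      intro s _
      set 𝓢 := (𝓡.filter fun ρ => ¬ (Nc ρ : ℝ) ≤ 2 * C₁ * p').filter
        fun ρ => Nat.log 2 (Nc ρ) = s with h𝓢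
      rcases 𝓢.eq_empty_or_nonempty with he | ⟨ρ₀, hρ₀⟩
      · rw [he, Finset.sum_empty]
        positivity
      set N : ℝ := 2 ^ s with hNdef
      have hNpos : 0 < N := by positivity
      have hmem : ∀ ρ ∈ 𝓢, ρ ∈ 𝓡 ∧ 2 * C₁ * p' < Nc ρ ∧ N ≤ Nc ρ ∧ (Nc ρ : ℝ) ≤ 2 * N := by
        intro ρ hρ
        rw [h𝓢, Finset.mem_filter, Finset.mem_filter, not_le] at hρ
        obtain ⟨⟨h1, h2⟩, h3⟩ := hρ
        have h4 : (0 : ℝ) < Nc ρ := lt_trans (by positivity) h2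
        have h5 : Nc ρ ≠ 0 := by
          intro h
          rw [h] at h4
          simp at h4
        refine ⟨h1, h2, ?_, ?_⟩
        · have := Nat.pow_log_le_self 2 h5
          rw [h3] at this
          rw [hNdef]
          exact_mod_cast this
        · have := (Nat.lt_pow_succ_log_self (b := 2) (by norm_num) (Nc ρ)).le
          rw [h3, pow_succ] at this
          rw [hNdef, mul_comm]
          exact_mod_cast this
      obtain ⟨hm1, hm2, hm3, hm4⟩ := hmem ρ₀ hρ₀
      set q : ℝ := C₁ * P / N with hqdef
      have hNq : N * q = C₁ * P := by rw [hqdef]; field_simp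
      have hq1 : 1 ≤ q := by
        rw [hqdef, one_le_div hNpos]
        have h1 := hNle ρ₀ hm1
        have h2 : (12 : ℝ) ^ n ≤ C₁ := by
          have h3 : (12 : ℝ) ^ n ≤ 96 ^ n := by gcongr; norm_num
          have h4 : (1 : ℝ) ≤ n := by exact_mod_cast hn
          have h5 : (1 : ℝ) ≤ 2 * n ^ 2 := by nlinarith
          rw [hC₁]
          nlinarith [pow_pos (show (0 : ℝ) < 96 by norm_num) n]
        calc N ≤ 12 ^ n * P := hm3.trans h1
          _ ≤ C₁ * P := by gcongr
      -- The threshold `2 * C₁ * p'` enters here; its factor 2 pays for replacing the number of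
      -- vectors by the power of two below it.
      have hqp : q ≤ p := by
        rw [hqdef, div_le_iff₀ hNpos]
        have h1 : C₁ * p' ≤ N := by linarith
        calc C₁ * P = p * (C₁ * p') := by rw [← hpP]; ring
          _ ≤ p * N := by gcongr
      have hqP : q ^ n ≤ P := by
        rw [← hpn]
        gcongr
      have hcard := card_mul_le_of_le_ncard hn hM 𝓢 (fun ρ hρ => h𝓡 ρ (hmem ρ hρ).1)
        (fun ρ hρ => h𝓡c ρ (hmem ρ hρ).1) (fun ρ hρ => (hmem ρ hρ).2.2.1) hNq hq1 hqP
      have hNeq : N = C₁ * P / q := by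
        rw [← hNq]
        field_simp
      calc ∑ ρ ∈ 𝓢, (Gc ρ : ℝ) * (Nc ρ : ℝ) ^ k ≤ ∑ ρ ∈ 𝓢, (2 * N) ^ (k + 1) := by
            refine Finset.sum_le_sum fun ρ hρ => ?_
            obtain ⟨h1, _, _, h4⟩ := hmem ρ hρ
            have h5 : (Gc ρ : ℝ) ≤ Nc ρ := by exact_mod_cast hGN ρ h1
            rw [pow_succ']
            gcongr
            exact h5.trans h4
        _ = 2 ^ (k + 1) * N ^ k * (𝓢.card * N) := by
            rw [Finset.sum_const, nsmul_eq_mul]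
            ring
        _ ≤ 2 ^ (k + 1) * N ^ k * (C₂ * P * q ^ (n * (n - 1))) := by
            gcongr
        _ = 2 ^ (k + 1) * C₁ ^ k * C₂ * (P ^ (k + 1) * (q ^ (n * (n - 1)) / q ^ k)) := by
            rw [hNeq, div_pow, mul_pow]
            ring
        _ ≤ _ := by
            gcongr
            exact pow_mul_pow_div_le hn k hq1 hqP
    refine (Finset.sum_le_sum hclass).trans_eq ?_
    rw [Finset.sum_const, nsmul_eq_mul, Finset.card_range]
    push_cast
    ring
  have hPμ : 0 < P ^ μ := by positivity
  calc ∑ ρ ∈ 𝓡, (Gc ρ : ℝ) * (Nc ρ : ℝ) ^ k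
      = ∑ ρ ∈ 𝓡 with (Nc ρ : ℝ) ≤ 2 * C₁ * p', (Gc ρ : ℝ) * (Nc ρ : ℝ) ^ k +
        ∑ ρ ∈ 𝓡 with ¬ (Nc ρ : ℝ) ≤ 2 * C₁ * p', (Gc ρ : ℝ) * (Nc ρ : ℝ) ^ k :=
        (Finset.sum_filter_add_sum_filter_not _ _ _).symm
    _ ≤ (2 * C₁) ^ k * C₃ * P ^ μ + (S + 1) * (2 ^ (k + 1) * C₁ ^ k * C₂ * P ^ μ) :=
        add_le_add hsmall hlarge
    _ ≤ (2 * C₁) ^ k * C₃ * P ^ μ * (2 + Real.logb 2 (12 ^ n * P)) +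
        (2 + Real.logb 2 (12 ^ n * P)) * (2 ^ (k + 1) * C₁ ^ k * C₂ * P ^ μ) := by
        refine add_le_add (le_mul_of_one_le_right (by positivity) (by linarith))
          (mul_le_mul_of_nonneg_right (by linarith) (by positivity))
    _ = _ := by ring

end MainCount

/-! ### Counting tuples of equivariant vectors -/

section Tuples

variable {n : ℕ}

/-- Two indices collide only if `t` is a root of a nonzero polynomial of degree at most `k`. The
product over all pairs has degree at most `n * n * k`, so one of `n * n * k + 1` values avoids every
collision. -/
theorem exists_injective_sum_pow_mul {k : ℕ} {x : Fin (k + 1) → Fin n → QBar}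
    (hx : Function.Injective fun i j => x j i) :
    ∃ t ∈ Finset.range (n * n * k + 1),
      Function.Injective fun i => ∑ j : Fin (k + 1), (t : QBar) ^ (j : ℕ) * x j i := by
  classical
  let d : Fin n × Fin n → Polynomial QBar := fun p =>
    ∑ j : Fin (k + 1), C (x j p.1 - x j p.2) * X ^ (j : ℕ)
  let s : Finset (Fin n × Fin n) := Finset.univ.filter fun p => p.1 ≠ p.2
  have hd : ∀ p ∈ s, d p ≠ 0 := by
    intro p hp h0
    refine (Finset.mem_filter.mp hp).2 (hx (funext fun j => ?_))
    have h1 : (d p).coeff j = 0 := by rw [h0, coeff_zero]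
    simp only [d, finsetSum_coeff, coeff_C_mul, coeff_X_pow] at h1
    rw [Finset.sum_eq_single j] at h1
    · simpa [sub_eq_zero] using h1
    · intro b _ hb
      rw [if_neg fun h => hb (Fin.ext h.symm), mul_zero]
    · simp
  have hdeg : ∀ p, (d p).natDegree ≤ k := fun p =>
    natDegree_sum_le_of_forall_le _ _ fun j _ =>
      (natDegree_C_mul_X_pow_le _ _).trans (Nat.lt_succ_iff.mp j.2)
  have hprod : ∏ p ∈ s, d p ≠ 0 := Finset.prod_ne_zero_iff.mpr hd
  have hproddeg : (∏ p ∈ s, d p).natDegree ≤ n * n * k := by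
    refine (natDegree_prod_le _ _).trans ((Finset.sum_le_card_nsmul s _ k fun p _ => hdeg p).trans ?_)
    rw [smul_eq_mul]
    gcongr
    exact (Finset.card_filter_le _ _).trans (by simp)
  have hex : ∃ t ∈ Finset.range (n * n * k + 1), (∏ p ∈ s, d p).eval (t : QBar) ≠ 0 := by
    by_contra! h
    refine hprod (eq_zero_of_natDegree_lt_card_of_eval_eq_zero' _
      ((Finset.range (n * n * k + 1)).image fun t : ℕ => (t : QBar)) ?_ ?_)
    · intro z hz
      obtain ⟨t, ht, rfl⟩ := Finset.mem_image.mp hz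
      exact h t ht
    · rw [Finset.card_image_of_injective _ Nat.cast_injective, Finset.card_range]
      omega
  obtain ⟨t, ht, hne⟩ := hex
  refine ⟨t, ht, fun i i' h => ?_⟩
  by_contra hii
  rw [eval_prod, Finset.prod_ne_zero_iff] at hne
  refine hne (i, i') (by simpa [s] using hii) ?_
  simp only [d, eval_finsetSum, eval_mul, eval_C, eval_pow, eval_X]
  have h' : ∑ j : Fin (k + 1), (t : QBar) ^ (j : ℕ) * x j i =
    ∑ j : Fin (k + 1), (t : QBar) ^ (j : ℕ) * x j i' := h
  rw [← sub_eq_zero, ← Finset.sum_sub_distrib] at h'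
  rw [← h']
  exact Finset.sum_congr rfl fun j _ => by ring

theorem sum_pow_mul_mem {k : ℕ} {ρ : Gal(QBar/ℚ) → Fin n → Fin n} {m : Fin n → ℝ}
    {x : Fin (k + 1) → Fin n → QBar} (hx : ∀ j, x j ∈ boundedIntegers ρ m) {t T : ℕ}
    (ht : t ≤ T) (hT : 1 ≤ T) :
    (fun i => ∑ j : Fin (k + 1), (t : QBar) ^ (j : ℕ) * x j i) ∈
      boundedIntegers ρ fun i => ((k + 1) * T ^ k : ℝ) * m i := by
  refine ⟨⟨fun i => IsIntegral.sum _ fun j _ => ?_, fun γ i => ?_⟩, fun i => ?_⟩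
  · exact (IsIntegral.pow (by simpa using isIntegral_algebraMap (R := ℤ) (A := QBar) (x := t)) _).mul
      ((hx j).1.1 i)
  · simp [map_sum, (hx _).1.2 γ i]
  · have hnat : ‖(t : QBar)‖ = t := by
      change ‖((t : QBar) : ℂ)‖ = _
      simp
    refine (norm_sum_le _ _).trans ?_
    calc ∑ j : Fin (k + 1), ‖(t : QBar) ^ (j : ℕ) * x j i‖
        ≤ ∑ j : Fin (k + 1), (T : ℝ) ^ k * m i := by
          refine Finset.sum_le_sum fun j _ => ?_
          rw [norm_mul, norm_pow, hnat]
          have h1 : (t : ℝ) ^ (j : ℕ) ≤ (T : ℝ) ^ k :=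
            calc (t : ℝ) ^ (j : ℕ) ≤ (T : ℝ) ^ (j : ℕ) := by gcongr
              _ ≤ (T : ℝ) ^ k := pow_le_pow_right₀ (by exact_mod_cast hT)
                (Nat.lt_succ_iff.mp j.2)
          exact mul_le_mul h1 ((hx j).2 i) (norm_nonneg _) (by positivity)
      _ = _ := by
          rw [Finset.sum_const, nsmul_eq_mul, Finset.card_univ, Fintype.card_fin]
          push_cast
          ring

theorem card_tuples_le_of_bound (hn : 0 < n) (k : ℕ) : ∃ K D : ℝ, 0 < K ∧ 1 ≤ D ∧
    ∀ m : Fin n → ℝ, (∀ i, 1 ≤ m i) → ∀ F : Finset (Fin (k + 1) → Fin n → QBar),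
      (∀ x ∈ F, ∃ ρ, IsTransitiveAction ρ ∧ (∀ i, m (ρ conjBar i) = m i) ∧
        (∀ j, x j ∈ boundedIntegers ρ m) ∧ Function.Injective fun i j => x j i) →
      (F.card : ℝ) ≤ K * (D * ∏ i, m i) ^ countExponent n k *
        (2 + Real.logb 2 (12 ^ n * (D * ∏ i, m i))) := by
  classical
  obtain ⟨K, hK, hmain⟩ := sum_ncard_mul_pow_le hn k
  set T : ℕ := n * n * k + 1 with hT
  have hT1 : 1 ≤ T := by omega
  set D₀ : ℝ := (k + 1) * T ^ k with hD₀
  have hTk : (1 : ℝ) ≤ (T : ℝ) ^ k := one_le_pow₀ (by exact_mod_cast hT1)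
  have hD₀1 : 1 ≤ D₀ := by
    have : (0 : ℝ) ≤ k := by positivity
    nlinarith
  refine ⟨T * K, D₀ ^ n, by positivity, one_le_pow₀ hD₀1, ?_⟩
  intro m hm F hF
  set M : Fin n → ℝ := fun i => D₀ * m i with hM
  have hM1 : ∀ i, 1 ≤ M i := fun i => by
    have := hm i
    simp only [hM]
    nlinarith
  have hmM : ∀ i, m i ≤ M i := fun i => by
    have := hm i
    simp only [hM]
    nlinarith
  have hchoice : ∀ x : Fin (k + 1) → Fin n → QBar, ∃ p : ℕ × (Gal(QBar/ℚ) → Fin n → Fin n),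
      x ∈ F → p.1 ∈ Finset.range T ∧ IsTransitiveAction p.2 ∧ (∀ i, m (p.2 conjBar i) = m i) ∧
        (∀ j, x j ∈ boundedIntegers p.2 m) ∧
        Function.Injective fun i => ∑ j : Fin (k + 1), (p.1 : QBar) ^ (j : ℕ) * x j i := by
    intro x
    by_cases hx : x ∈ F
    · obtain ⟨ρ, h1, h2, h3, h4⟩ := hF x hx
      obtain ⟨t, ht, hti⟩ := exists_injective_sum_pow_mul h4
      exact ⟨(t, ρ), fun _ => ⟨ht, h1, h2, h3, hti⟩⟩
    · exact ⟨(0, fun _ => id), fun h => absurd h hx⟩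
  choose key hkey using hchoice
  set 𝓡 := F.image fun x => (key x).2 with h𝓡def
  have h𝓡 : ∀ ρ ∈ 𝓡, IsTransitiveAction ρ ∧ ∀ i, M (ρ conjBar i) = M i := by
    intro ρ hρ
    obtain ⟨x, hx, rfl⟩ := Finset.mem_image.mp hρ
    exact ⟨(hkey x hx).2.1, fun i => by simp only [hM, (hkey x hx).2.2.1 i]⟩
  have hP : ∏ i, M i = D₀ ^ n * ∏ i, m i := by
    rw [hM, Finset.prod_mul_distrib, Finset.prod_const, Finset.card_univ, Fintype.card_fin]
  have hsum := hmain M hM1 𝓡 (fun ρ hρ => (h𝓡 ρ hρ).1) (fun ρ hρ => (h𝓡 ρ hρ).2)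
  rw [hP] at hsum
  have hfin : ∀ ρ ∈ 𝓡, (boundedIntegers ρ M).Finite := fun ρ hρ => by
    have hpos : 0 ≤ ∏ i, M i := Finset.prod_nonneg fun i _ => zero_le_one.trans (hM1 i)
    have h1 : (1 : ℝ) ≤ ∏ i, M i := by
      simpa using Finset.prod_le_prod (s := Finset.univ) (f := fun _ : Fin n => (1 : ℝ))
        (fun _ _ => zero_le_one) fun i _ => hM1 i
    refine (boundedIntegers_finite_and_ncard_le (q := (∏ i, M i) ^ (1 / (n : ℝ)))
      (h𝓡 ρ hρ).1 hn hM1 (h𝓡 ρ hρ).2 (Real.one_le_rpow h1 (by positivity)) ?_).1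
    rw [← Real.rpow_natCast, ← Real.rpow_mul hpos, one_div_mul_cancel (by exact_mod_cast hn.ne'),
      Real.rpow_one]
  have hmaps : ∀ x ∈ F, key x ∈ Finset.range T ×ˢ 𝓡 := fun x hx =>
    Finset.mem_product.mpr ⟨(hkey x hx).1, Finset.mem_image_of_mem _ hx⟩
  have hfiber : ∀ p ∈ Finset.range T ×ˢ 𝓡, ((F.filter fun x => key x = p).card : ℝ) ≤
      ((boundedGenerators p.2 M).ncard : ℝ) * (boundedIntegers p.2 M).ncard ^ k := by
    rintro ⟨t, ρ⟩ hp
    have hN := hfin ρ (Finset.mem_product.mp hp).2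
    have hG : (boundedGenerators ρ M).Finite := hN.subset fun x hx => hx.1
    have hcard : (F.filter fun x => key x = (t, ρ)).card ≤
        (hG.toFinset ×ˢ Fintype.piFinset fun _ : Fin k => hN.toFinset).card := by
      -- Send a tuple to its generator and its last `k` members. The member with index 0 is
      -- recovered because its coefficient in the combination is `t ^ 0 = 1`.
      refine Finset.card_le_card_of_injOn
        (fun x => (fun i => ∑ j : Fin (k + 1), (t : QBar) ^ (j : ℕ) * x j i,
          fun j => x j.succ)) ?_ ?_
      · intro x hx
        obtain ⟨hxF, hxk⟩ := Finset.mem_filter.mp hx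
        obtain ⟨h1, h2, h3, h4, h5⟩ := hkey x hxF
        rw [hxk] at h1 h2 h3 h4 h5
        simp only [Finset.coe_product, Set.mem_prod, Finset.mem_coe, Set.Finite.mem_toFinset,
          Fintype.mem_piFinset]
        exact ⟨⟨sum_pow_mul_mem h4 (Finset.mem_range.mp h1).le hT1, h5⟩,
          fun j => ⟨(h4 _).1, fun i => ((h4 _).2 i).trans (hmM i)⟩⟩
      · intro x _ y _ hxy
        obtain ⟨h1, h2⟩ := Prod.mk.inj hxy
        have h3 : ∀ j : Fin k, x j.succ = y j.succ := fun j => congrFun h2 j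
        funext j i
        refine Fin.cases ?_ (fun j => congrFun (h3 j) i) j
        have h4 := congrFun h1 i
        simp only [Fin.sum_univ_succ, h3] at h4
        simpa using h4
    rw [Finset.card_product, Fintype.card_piFinset_const] at hcard
    rw [Set.ncard_eq_toFinset_card _ hN, Set.ncard_eq_toFinset_card _ hG]
    exact_mod_cast hcard
  rw [Finset.card_eq_sum_card_fiberwise hmaps, Nat.cast_sum]
  refine (Finset.sum_le_sum hfiber).trans ?_
  rw [Finset.sum_product]
  dsimp only
  rw [Finset.sum_const, nsmul_eq_mul, Finset.card_range]
  calc (T : ℝ) * _ ≤ T * _ := mul_le_mul_of_nonneg_left hsum (by positivity)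
    _ = _ := by ring

/-! ### Dyadic decomposition of the height -/

theorem exists_two_add_logb_pow_le (a : ℝ) (ha : 1 ≤ a) (r : ℕ) {ε : ℝ} (hε : 0 < ε) :
    ∃ C : ℝ, 0 < C ∧ ∀ H : ℝ, 1 ≤ H → (2 + Real.logb 2 (a * H)) ^ r ≤ C * H ^ ε := by
  set δ : ℝ := ε / (r + 1) with hδ
  have hδ0 : 0 < δ := by positivity
  have hlog2 : 0 < Real.log 2 := Real.log_pos (by norm_num)
  refine ⟨(2 + a ^ δ / δ / Real.log 2) ^ r, by positivity, fun H hH => ?_⟩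
  have hHδ : 1 ≤ H ^ δ := Real.one_le_rpow hH hδ0.le
  have h1 : Real.logb 2 (a * H) ≤ a ^ δ / δ / Real.log 2 * H ^ δ := by
    rw [Real.logb]
    calc Real.log (a * H) / Real.log 2 ≤ ((a * H) ^ δ / δ) / Real.log 2 := by
          gcongr
          exact Real.log_le_rpow_div (by positivity) hδ0
      _ = _ := by
          rw [Real.mul_rpow (by linarith) (by linarith)]
          ring
  have h0 : 0 ≤ Real.logb 2 (a * H) := Real.logb_nonneg (by norm_num) (by nlinarith)
  calc (2 + Real.logb 2 (a * H)) ^ r ≤ ((2 + a ^ δ / δ / Real.log 2) * H ^ δ) ^ r := by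
        gcongr
        rw [add_mul]
        exact add_le_add (by linarith) h1
    _ = (2 + a ^ δ / δ / Real.log 2) ^ r * H ^ (δ * r) := by
        rw [mul_pow, Real.rpow_mul (by linarith), Real.rpow_natCast]
    _ ≤ _ := by
        gcongr
        rw [hδ, div_mul_eq_mul_div, div_le_iff₀ (by positivity)]
        nlinarith

theorem card_tuples_le (hn : 0 < n) (k : ℕ) {ε : ℝ} (hε : 0 < ε) : ∃ K : ℝ, 0 < K ∧
    ∀ H : ℝ, 1 ≤ H → ∀ F : Finset (Fin (k + 1) → Fin n → QBar),
      (∀ x ∈ F, ∃ ρ, IsTransitiveAction ρ ∧ (∀ j, x j ∈ equivariantIntegers ρ) ∧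
        (Function.Injective fun i j => x j i) ∧ ∏ i, (1 + ∑ j, ‖x j i‖) ≤ H) →
      (F.card : ℝ) ≤ K * H ^ (countExponent n k + ε) := by
  classical
  obtain ⟨K, D, hK, hD, hmain⟩ := card_tuples_le_of_bound hn k
  have ha : (1 : ℝ) ≤ 12 ^ n * (D * 4 ^ n) := by
    have h1 : (1 : ℝ) ≤ 12 ^ n := one_le_pow₀ (by norm_num)
    have h2 : (1 : ℝ) ≤ 4 ^ n := one_le_pow₀ (by norm_num)
    exact one_le_mul_of_one_le_of_one_le h1 (one_le_mul_of_one_le_of_one_le hD h2)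
  obtain ⟨C', hC', hlog⟩ := exists_two_add_logb_pow_le _ ha (n + 1) hε
  set e := countExponent n k with he
  have he0 : 0 ≤ e := le_max_of_le_left (by positivity)
  refine ⟨K * (D * 4 ^ n) ^ e * C', by positivity, fun H hH F hF => ?_⟩
  let B : (Fin (k + 1) → Fin n → QBar) → Fin n → ℝ := fun x i => 1 + ∑ j, ‖x j i‖
  have hB1 : ∀ x i, 1 ≤ B x i := fun x i =>
    le_add_of_nonneg_right (Finset.sum_nonneg fun _ _ => norm_nonneg _)
  -- The dyadic scales satisfy `B ≤ 2 ^ u ≤ 4 * B`. They are invariant under complex conjugation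
  -- since norms are, as the box count requires.
  let u : (Fin (k + 1) → Fin n → QBar) → Fin n → ℕ := fun x i => Nat.clog 2 ⌈B x i⌉₊
  have hBu : ∀ x i, B x i ≤ 2 ^ u x i := fun x i =>
    (Nat.le_ceil _).trans (by exact_mod_cast Nat.le_pow_clog (by norm_num) _)
  have huB : ∀ x i, (2 : ℝ) ^ u x i ≤ 4 * B x i := by
    intro x i
    have h1 := hB1 x i
    rcases Nat.lt_or_ge 1 ⌈B x i⌉₊ with h | h
    · have h2 := Nat.pow_pred_clog_lt_self (b := 2) (by norm_num) h
      have h3 : 0 < Nat.clog 2 ⌈B x i⌉₊ := Nat.clog_pos (by norm_num) h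
      have h4 : (2 : ℝ) ^ (Nat.clog 2 ⌈B x i⌉₊).pred ≤ ⌈B x i⌉₊ := by exact_mod_cast h2.le
      have h5 : (2 : ℝ) ^ u x i = 2 * 2 ^ (Nat.clog 2 ⌈B x i⌉₊).pred := by
        rw [← pow_succ', ← Nat.succ_eq_add_one, Nat.succ_pred_eq_of_pos h3]
      have h6 := Nat.ceil_lt_add_one (zero_le_one.trans h1)
      rw [h5]
      linarith
    · have : u x i = 0 := Nat.clog_of_right_le_one h _
      rw [this, pow_zero]
      linarith
  have hprod : ∀ x ∈ F, ∏ i, (2 : ℝ) ^ u x i ≤ 4 ^ n * H := by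
    intro x hx
    obtain ⟨ρ, -, -, -, h⟩ := hF x hx
    calc ∏ i, (2 : ℝ) ^ u x i ≤ ∏ i, 4 * B x i :=
          Finset.prod_le_prod (fun _ _ => by positivity) fun i _ => huB x i
      _ = 4 ^ n * ∏ i, B x i := by
          rw [Finset.prod_mul_distrib, Finset.prod_const, Finset.card_univ, Fintype.card_fin]
      _ ≤ _ := by gcongr
  have hH4 : (1 : ℝ) ≤ 4 ^ n * H :=
    one_le_mul_of_one_le_of_one_le (one_le_pow₀ (by norm_num)) hH
  set U : ℕ := ⌊Real.logb 2 (4 ^ n * H)⌋₊ with hU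
  have hmaps : ∀ x ∈ F, u x ∈ Fintype.piFinset fun _ : Fin n => Finset.range (U + 1) := by
    intro x hx
    rw [Fintype.mem_piFinset]
    intro i
    rw [Finset.mem_range, Nat.lt_succ_iff]
    refine Nat.le_floor ?_
    rw [Real.le_logb_iff_rpow_le (by norm_num) (by linarith), Real.rpow_natCast]
    refine le_trans ?_ (hprod x hx)
    rw [← Finset.mul_prod_erase _ _ (Finset.mem_univ i)]
    refine le_mul_of_one_le_right (by positivity) ?_
    simpa using Finset.prod_le_prod (s := Finset.univ.erase i) (f := fun _ : Fin n => (1 : ℝ))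
      (g := fun j => (2 : ℝ) ^ u x j) (fun _ _ => zero_le_one)
      fun j _ => one_le_pow₀ (by norm_num)
  set Λ : ℝ := 2 + Real.logb 2 (12 ^ n * (D * 4 ^ n) * H) with hΛ
  have hmono : Real.logb 2 (4 ^ n * H) ≤ Real.logb 2 (12 ^ n * (D * 4 ^ n) * H) := by
    refine Real.logb_le_logb_of_le (by norm_num) (by linarith) ?_
    have h1 : (1 : ℝ) ≤ 12 ^ n := one_le_pow₀ (by norm_num)
    calc 4 ^ n * H ≤ (12 ^ n * D) * (4 ^ n * H) :=
          le_mul_of_one_le_left (by linarith) (one_le_mul_of_one_le_of_one_le h1 hD)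
      _ = _ := by ring
  have hlog0 : 0 ≤ Real.logb 2 (4 ^ n * H) := Real.logb_nonneg (by norm_num) hH4
  have hfiber : ∀ v ∈ Fintype.piFinset fun _ : Fin n => Finset.range (U + 1),
      ((F.filter fun x => u x = v).card : ℝ) ≤ K * (D * 4 ^ n * H) ^ e * Λ := by
    intro v _
    rcases (F.filter fun x => u x = v).eq_empty_or_nonempty with h | ⟨x₀, hx₀⟩
    · rw [h, Finset.card_empty, Nat.cast_zero]
      have : 0 ≤ Λ := by linarith
      positivity
    have h1 := hmain (fun i => 2 ^ v i) (fun i => one_le_pow₀ (by norm_num))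
      (F.filter fun x => u x = v) (by
        intro x hx
        obtain ⟨hxF, rfl⟩ := Finset.mem_filter.mp hx
        obtain ⟨ρ, h1, h2, h3, -⟩ := hF x hxF
        refine ⟨ρ, h1, fun i => ?_, fun j => ⟨h2 j, fun i => ?_⟩, h3⟩
        · simp only [u, B, norm_apply_conjBar (h2 _)]
        · refine le_trans ?_ (hBu x i)
          have := Finset.single_le_sum (f := fun j => ‖x j i‖) (fun _ _ => norm_nonneg _)
            (Finset.mem_univ j)
          exact this.trans (le_add_of_nonneg_left zero_le_one))
    have hv1 : (1 : ℝ) ≤ ∏ i, (2 : ℝ) ^ v i := by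
      simpa using Finset.prod_le_prod (s := Finset.univ) (f := fun _ : Fin n => (1 : ℝ))
        (g := fun j => (2 : ℝ) ^ v j) (fun _ _ => zero_le_one)
        fun j _ => one_le_pow₀ (by norm_num)
    obtain ⟨hx₀F, rfl⟩ := Finset.mem_filter.mp hx₀
    have h2 := hprod x₀ hx₀F
    have h3 : D * ∏ i, (2 : ℝ) ^ u x₀ i ≤ D * 4 ^ n * H := by
      rw [mul_assoc]
      gcongr
    have h12 : (1 : ℝ) ≤ 12 ^ n := one_le_pow₀ (by norm_num)
    have h4 : Real.logb 2 (12 ^ n * (D * ∏ i, (2 : ℝ) ^ u x₀ i)) ≤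
        Real.logb 2 (12 ^ n * (D * 4 ^ n) * H) := by
      refine Real.logb_le_logb_of_le (by norm_num) (by positivity) ?_
      rw [mul_assoc (12 ^ n : ℝ)]
      gcongr
    have h5 : 0 ≤ Real.logb 2 (12 ^ n * (D * ∏ i, (2 : ℝ) ^ u x₀ i)) :=
      Real.logb_nonneg (by norm_num)
        (one_le_mul_of_one_le_of_one_le h12 (one_le_mul_of_one_le_of_one_le hD hv1))
    refine h1.trans ?_
    have h6 : (D * ∏ i, (2 : ℝ) ^ u x₀ i) ^ e ≤ (D * 4 ^ n * H) ^ e :=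
      Real.rpow_le_rpow (by positivity) h3 he0
    rw [hΛ]
    gcongr
  have hΛ0 : 0 ≤ Λ := by linarith
  rw [Finset.card_eq_sum_card_fiberwise hmaps, Nat.cast_sum]
  calc _ ≤ ∑ v ∈ Fintype.piFinset fun _ : Fin n => Finset.range (U + 1),
        K * (D * 4 ^ n * H) ^ e * Λ := Finset.sum_le_sum hfiber
    _ = (U + 1) ^ n * (K * (D * 4 ^ n * H) ^ e * Λ) := by
        rw [Finset.sum_const, nsmul_eq_mul, Fintype.card_piFinset_const, Finset.card_range]
        push_cast
        rfl
    _ ≤ Λ ^ n * (K * (D * 4 ^ n * H) ^ e * Λ) := by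
        have : (U : ℝ) + 1 ≤ Λ := by
          have := Nat.floor_le hlog0
          linarith
        gcongr
    -- There are `n` logarithms from the choice of a box and one from the count within it; all are
    -- absorbed in `H ^ ε`.
    _ = K * (D * 4 ^ n * H) ^ e * Λ ^ (n + 1) := by ring
    _ ≤ K * (D * 4 ^ n * H) ^ e * (C' * H ^ ε) := by
        gcongr
        exact hlog H hH
    _ = _ := by
        rw [Real.mul_rpow (by positivity) (by linarith), Real.rpow_add (by linarith)]
        ring

end Tuples

/-! ### Block polynomials -/

theorem conjBar_mul_self : conjBar * conjBar = 1 := by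
  ext x
  change ((conjBar (conjBar x) : QBar) : ℂ) = x
  rw [coe_conjBar, coe_conjBar, Complex.conj_conj]

/-- A polynomial whose roots are permuted transitively by the Galois group, compatibly with a
partition into `n` blocks, is a product of conjugate polynomials whose coefficients form
equivariant vectors. -/
theorem exists_block_polynomials {α : Type*} [Fintype α] {n k : ℕ} (hn : 0 < n)
    (hcard : Fintype.card α = n * (k + 1)) (r : α → QBar) (hr : Function.Injective r)
    (hint : ∀ a, IsIntegral ℤ (r a)) (π : Gal(QBar/ℚ) → α → α)
    (hπ : ∀ γ a, r (π γ a) = γ (r a)) (htrans : ∀ a b, ∃ γ, π γ a = b) (blk : α → Fin n)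
    (hsurj : Function.Surjective blk)
    (hblk : ∀ γ a b, blk a = blk b → blk (π γ a) = blk (π γ b)) :
    ∃ (ρ : Gal(QBar/ℚ) → Fin n → Fin n) (x : Fin (k + 1) → Fin n → QBar),
      IsTransitiveAction ρ ∧ (∀ j, x j ∈ equivariantIntegers ρ) ∧
      (Function.Injective fun i j => x j i) ∧
      (∏ i, (X ^ (k + 1) + ∑ j : Fin (k + 1), C (x j i) * X ^ (j : ℕ)) : Polynomial QBar) =
        ∏ a, (X - C (r a)) ∧
      ∏ i, (1 + ∑ j, ‖x j i‖) ≤ (1 + (k + 1) * 2 ^ (k + 1)) ^ n * ∏ a, max 1 ‖r a‖ := by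
  classical
  obtain ⟨s, hs⟩ := hsurj.hasRightInverse
  have hπmul : ∀ γ δ a, π (γ * δ) a = π γ (π δ a) := fun γ δ a => hr (by simp [hπ])
  have hπone : ∀ a, π 1 a = a := fun a => hr (by simp [hπ])
  let e : Gal(QBar/ℚ) → α ≃ α := fun γ =>
    ⟨π γ, π γ⁻¹, fun a => by rw [← hπmul, inv_mul_cancel, hπone],
      fun a => by rw [← hπmul, mul_inv_cancel, hπone]⟩
  let ρ : Gal(QBar/ℚ) → Fin n → Fin n := fun γ i => blk (π γ (s i))
  have hρ : ∀ γ a, ρ γ (blk a) = blk (π γ a) := fun γ a => hblk _ _ _ (hs _)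
  have hρmul : ∀ γ δ i, ρ (γ * δ) i = ρ γ (ρ δ i) := fun γ δ i => by
    change blk (π (γ * δ) (s i)) = ρ γ (blk (π δ (s i)))
    rw [hρ, hπmul]
  have hρone : ∀ i, ρ 1 i = i := fun i => by
    change blk (π 1 (s i)) = i
    rw [hπone, hs]
  have hact : IsTransitiveAction ρ := by
    refine ⟨fun γ => Function.bijective_iff_has_inverse.mpr ⟨ρ γ⁻¹, fun i => ?_, fun i => ?_⟩,
      fun i j => ?_, fun i => ?_⟩
    · rw [← hρmul, inv_mul_cancel, hρone]
    · rw [← hρmul, mul_inv_cancel, hρone]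
    · obtain ⟨γ, hγ⟩ := htrans (s i) (s j)
      exact ⟨γ, by change blk (π γ (s i)) = j; rw [hγ, hs]⟩
    · rw [← hρmul, conjBar_mul_self, hρone]
  let A : Fin n → Finset α := fun i => Finset.univ.filter fun a => blk a = i
  have hA : ∀ γ i a, a ∈ A i ↔ e γ a ∈ A (ρ γ i) := by
    intro γ i a
    simp only [A, Finset.mem_filter, Finset.mem_univ, true_and]
    change _ ↔ blk (π γ a) = _
    rw [← hρ]
    exact (hact.bijective γ).1.eq_iff.symm
  have hAcard : ∀ i, (A i).card = k + 1 := by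
    have hconst : ∀ i j, (A i).card = (A j).card := by
      intro i j
      obtain ⟨γ, rfl⟩ := hact.transitive i j
      exact Finset.card_equiv (e γ) (hA γ i)
    intro i
    have h1 : Fintype.card α = ∑ j, (A j).card :=
      Finset.card_eq_sum_card_fiberwise fun a _ => Finset.mem_univ (blk a)
    rw [Finset.sum_congr rfl fun j _ => hconst j i, Finset.sum_const, Finset.card_univ,
      Fintype.card_fin, smul_eq_mul, hcard] at h1
    exact (Nat.eq_of_mul_eq_mul_left hn h1).symm
  let g : Fin n → Polynomial QBar := fun i => ∏ a ∈ A i, (X - C (r a))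
  have hg : ∀ (γ : Gal(QBar/ℚ)) i, (g i).map (γ : QBar →+* QBar) = g (ρ γ i) := by
    intro γ i
    rw [Polynomial.map_prod]
    refine Finset.prod_equiv (e γ) (hA γ i) fun a _ => ?_
    change _ = X - C (r (π γ a))
    rw [hπ]
    simp
  have hgdeg : ∀ i, (g i).natDegree = k + 1 := fun i => by
    rw [natDegree_finsetProd_X_sub_C_eq_card, hAcard]
  have hgsum : ∀ i, X ^ (k + 1) + ∑ j : Fin (k + 1), C ((g i).coeff j) * X ^ (j : ℕ) = g i := by
    intro i
    have h := (monic_prod_X_sub_C r (A i)).as_sum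
    rw [hgdeg i, Finset.sum_range] at h
    exact h.symm
  refine ⟨ρ, fun j i => (g i).coeff j, hact, fun j => ⟨fun i => ?_, fun γ i => ?_⟩, ?_, ?_, ?_⟩
  · exact isIntegral_coeff_prod_X_sub_C _ _ (fun a _ => hint a) _
  · change (g (ρ γ i)).coeff j = _
    rw [← hg, coeff_map]
    rfl
  -- Distinct blocks give distinct factors, since the roots are distinct and a common root would lie
  -- in both blocks.
  · intro i i' h
    have h1 : g i = g i' := by
      rw [← hgsum i, ← hgsum i']
      congr 1
      refine Finset.sum_congr rfl fun j _ => ?_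
      have := congrFun h j
      dsimp only at this
      rw [this]
    have h2 : (g i').eval (r (s i)) = 0 := by
      rw [← h1, eval_prod]
      exact Finset.prod_eq_zero (i := s i) (by simp [A, hs i]) (by simp)
    rw [eval_prod, Finset.prod_eq_zero_iff] at h2
    obtain ⟨a, ha, h3⟩ := h2
    rw [eval_sub, eval_X, eval_C, sub_eq_zero] at h3
    rw [← (Finset.mem_filter.mp ha).2, ← hr h3, hs]
  · rw [Finset.prod_congr rfl fun i _ => hgsum i]
    exact Finset.prod_fiberwise _ _ _
  · have hprod : ∏ i, ∏ a ∈ A i, max 1 ‖r a‖ = ∏ a, max 1 ‖r a‖ :=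
      Finset.prod_fiberwise _ _ _
    calc ∏ i, (1 + ∑ j : Fin (k + 1), ‖(g i).coeff j‖)
        ≤ ∏ i, ((1 + (k + 1) * 2 ^ (k + 1)) * ∏ a ∈ A i, max 1 ‖r a‖) := by
          refine Finset.prod_le_prod (fun i _ => by positivity) fun i _ => ?_
          have hW : 1 ≤ ∏ a ∈ A i, max 1 ‖r a‖ := by
            simpa using Finset.prod_le_prod (s := A i) (f := fun _ => (1 : ℝ))
              (g := fun a => max 1 ‖r a‖) (fun _ _ => zero_le_one) fun a _ => le_max_left _ _
          have hmap : (∏ a ∈ A i, (X - C (r a : ℂ))) = (g i).map (algebraMap QBar ℂ) := by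
            rw [Polynomial.map_prod]
            exact Finset.prod_congr rfl fun a _ => by simp
          have hc : ∀ j : Fin (k + 1), ‖(g i).coeff j‖ ≤
              2 ^ (k + 1) * ∏ a ∈ A i, max 1 ‖r a‖ := fun j => by
            have h := norm_coeff_prod_X_sub_C_le (A i) (fun a => (r a : ℂ)) j
            rw [hmap, coeff_map, hAcard] at h
            exact h
          have hsum := Finset.sum_le_sum fun j (_ : j ∈ Finset.univ) => hc j
          rw [Finset.sum_const, nsmul_eq_mul, Finset.card_univ, Fintype.card_fin] at hsum
          push_cast at hsum
          linarith
      _ = _ := by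
          rw [Finset.prod_mul_distrib, Finset.prod_const, Finset.card_univ, Fintype.card_fin, hprod]

/-! ### The Galois action on the complex roots -/

theorem galActionHom_apply_of_algebraMap_eq (p : ℚ[X])
    [Fact ((p.map (algebraMap ℚ ℂ)).Splits)] (ϕ : p.Gal) (x : p.rootSet ℂ) {y : p.SplittingField}
    (hy : algebraMap p.SplittingField ℂ y = x) :
    ((Gal.galActionHom p ℂ ϕ x : p.rootSet ℂ) : ℂ) = algebraMap p.SplittingField ℂ (ϕ y) := by
  have h1 : (((Gal.rootsEquivRoots p ℂ).symm x : p.rootSet p.SplittingField) :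
      p.SplittingField) = y := by
    apply (algebraMap p.SplittingField ℂ).injective
    rw [hy]
    exact congrArg Subtype.val ((Gal.rootsEquivRoots p ℂ).apply_symm_apply x)
  rw [← h1]
  rfl

/-- The group of f is defined through its splitting field. Restriction to this normal field, and
lifting from it, identify its permutations of the roots with those induced by the absolute Galois
group. -/
theorem exists_perm_iff_galois (f : ℤ[X]) :
    (∀ γ : Gal(QBar/ℚ), ∃ g ∈ galoisPermGroup f, ∀ (x : (f.map (Int.castRingHom ℚ)).rootSet ℂ) (z : QBar), (z : ℂ) = x →
      ((γ z : QBar) : ℂ) = (g x : ℂ)) ∧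
    ∀ g ∈ galoisPermGroup f, ∃ γ : Gal(QBar/ℚ), ∀ (x : (f.map (Int.castRingHom ℚ)).rootSet ℂ) (z : QBar), (z : ℂ) = x →
      ((γ z : QBar) : ℂ) = (g x : ℂ) := by
  set p := f.map (Int.castRingHom ℚ) with hp
  have : Normal ℚ p.SplittingField := SplittingField.instNormal p
  have : Fact ((p.map (algebraMap ℚ ℂ)).Splits) := ⟨IsAlgClosed.splits _⟩
  let ι : p.SplittingField →ₐ[ℚ] ℂ := IsScalarTower.toAlgHom ℚ p.SplittingField ℂ
  have hι : ∀ y, ι y ∈ QBar := fun y =>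
    mem_algebraicClosure_iff.mpr ((Algebra.IsAlgebraic.isAlgebraic (R := ℚ) y).algHom ι)
  let j : p.SplittingField →ₐ[ℚ] QBar := ι.codRestrict QBar.toSubalgebra hι
  let _ : Algebra p.SplittingField QBar := j.toRingHom.toAlgebra
  have : IsScalarTower ℚ p.SplittingField QBar := IsScalarTower.of_algebraMap_eq fun q => by
    exact (j.commutes q).symm
  have hj : ∀ y, ((algebraMap p.SplittingField QBar y : QBar) : ℂ) =
      algebraMap p.SplittingField ℂ y := fun _ => rfl
  have hroot : ∀ x : p.rootSet ℂ, ∃ y, algebraMap p.SplittingField ℂ y = x := fun x =>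
    ⟨_, congrArg Subtype.val ((Gal.rootsEquivRoots p ℂ).apply_symm_apply x)⟩
  constructor
  · intro γ
    refine ⟨Gal.galActionHom p ℂ (γ.restrictNormal p.SplittingField), ⟨_, rfl⟩, fun x z hz => ?_⟩
    obtain ⟨y, hy⟩ := hroot x
    have hzy : z = algebraMap p.SplittingField QBar y := Subtype.ext (by rw [hz, hj, hy])
    refine Eq.trans ?_ (galActionHom_apply_of_algebraMap_eq p
      (γ.restrictNormal p.SplittingField) x hy).symm
    rw [hzy]
    exact congrArg Subtype.val (γ.restrictNormal_commutes p.SplittingField y).symm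
  · rintro g ⟨ϕ, rfl⟩
    let ϕ' : p.SplittingField ≃ₐ[ℚ] p.SplittingField := ϕ
    refine ⟨ϕ'.liftNormal QBar, fun x z hz => ?_⟩
    obtain ⟨y, hy⟩ := hroot x
    have hzy : z = algebraMap p.SplittingField QBar y := Subtype.ext (by rw [hz, hj, hy])
    refine Eq.trans ?_ (galActionHom_apply_of_algebraMap_eq p ϕ x hy).symm
    rw [hzy, ϕ'.liftNormal_commutes, hj]
    rfl

/-! ### From polynomials to tuples -/

theorem coeff_monicPoly_of_lt {n : ℕ} (a : Fin n → ℤ) (i : Fin n) :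
    (monicPoly n a).coeff i = a i := by
  simp only [monicPoly, coeff_add, coeff_X_pow, finsetSum_coeff, coeff_C_mul]
  rw [if_neg i.2.ne, zero_add, Finset.sum_eq_single i]
  · simp
  · intro j _ hj
    rw [if_neg fun h => hj (Fin.ext h.symm), mul_zero]
  · simp

theorem monicPoly_injective (n : ℕ) : Function.Injective (monicPoly n) := by
  intro a b h
  funext i
  rw [← coeff_monicPoly_of_lt a, h, coeff_monicPoly_of_lt]

theorem monicPoly_monic {n : ℕ} (a : Fin n → ℤ) : (monicPoly n a).Monic :=
  monic_X_pow_add (degree_sum_fin_lt a)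

theorem natDegree_monicPoly {n : ℕ} (a : Fin n → ℤ) : (monicPoly n a).natDegree = n :=
  natDegree_eq_of_degree_eq_some (by
    rw [monicPoly, degree_add_eq_left_of_degree_lt (by
      rw [degree_X_pow]
      exact degree_sum_fin_lt a), degree_X_pow])

theorem mahlerMeasure_monicPoly_le {n L : ℕ} (hL : 1 ≤ L) {a : Fin n → ℤ}
    (ha : a ∈ coeffBox n L) :
    ((monicPoly n a).map (Int.castRingHom ℂ)).mahlerMeasure ≤ (n + 1) * L := by
  refine (mahlerMeasure_le_sum_norm_coeff _).trans ?_
  have hL' : (1 : ℝ) ≤ L := by exact_mod_cast hL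
  have hdeg : ((monicPoly n a).map (Int.castRingHom ℂ)).natDegree = n := by
    rw [(monicPoly_monic a).natDegree_map, natDegree_monicPoly]
  rw [sum_over_range _ (fun _ => norm_zero), hdeg, Finset.sum_range_succ, Finset.sum_range]
  have h1 : ∀ i : Fin n, ‖((monicPoly n a).map (Int.castRingHom ℂ)).coeff i‖ ≤ L := by
    intro i
    rw [coeff_map, coeff_monicPoly_of_lt]
    have h2 := Finset.mem_Icc.mp (Fintype.mem_piFinset.mp ha i)
    simp only [eq_intCast, Complex.norm_intCast]
    exact abs_le.mpr ⟨by exact_mod_cast h2.1, by exact_mod_cast h2.2⟩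
  have h3 : ((monicPoly n a).map (Int.castRingHom ℂ)).coeff n = 1 := by
    have := (monicPoly_monic a).coeff_natDegree
    rw [natDegree_monicPoly] at this
    rw [coeff_map, this, map_one]
  have h4 := Finset.sum_le_sum fun i (_ : i ∈ Finset.univ) => h1 i
  rw [Finset.sum_const, nsmul_eq_mul, Finset.card_univ, Fintype.card_fin] at h4
  rw [h3, norm_one]
  linarith

theorem exists_block_function {α : Type*} {n : ℕ} (hn : 0 < n) {G : Subgroup (Equiv.Perm α)}
    {Λ : Set (Set α)} (hΛ : Setoid.IsPartition Λ) (hcard : Λ.ncard = n)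
    (hG : ∀ g ∈ G, ∀ B ∈ Λ, g '' B ∈ Λ) :
    ∃ blk : α → Fin n, Function.Surjective blk ∧
      ∀ g ∈ G, ∀ a b, blk a = blk b → blk (g a) = blk (g b) := by
  have hfin : Finite Λ := Set.finite_of_ncard_pos (by omega)
  let e : Λ ≃ Fin n := Finite.equivFinOfCardEq (by rw [Nat.card_coe_set_eq, hcard])
  choose B hB using fun a => (hΛ.2 a).exists
  have huniq : ∀ a, ∀ S ∈ Λ, a ∈ S → S = B a := fun a S hS ha =>
    (hΛ.2 a).unique ⟨hS, ha⟩ (hB a)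
  refine ⟨fun a => e ⟨B a, (hB a).1⟩, fun i => ?_, fun g hg a b hab => ?_⟩
  · obtain ⟨⟨S, hS⟩, rfl⟩ := e.surjective i
    have hne : S.Nonempty := Set.nonempty_iff_ne_empty.mpr fun h => hΛ.1 (h ▸ hS)
    obtain ⟨a, ha⟩ := hne
    exact ⟨a, congrArg e (Subtype.ext (huniq a S hS ha).symm)⟩
  · have h1 : B a = B b := congrArg Subtype.val (e.injective hab)
    have h2 := hG g hg _ (hB a).1
    refine congrArg e (Subtype.ext ?_)
    exact (huniq (g a) _ h2 (Set.mem_image_of_mem g (hB a).2)).symm.trans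
      (huniq (g b) _ h2 (Set.mem_image_of_mem g (h1 ▸ (hB b).2)))

theorem prod_X_sub_C_eq_of_card_roots {α K : Type*} [Fintype α] [Field K] {r : α → K}
    (hr : Function.Injective r) {f : K[X]} (hf : f.Monic) (hroot : ∀ a, f.eval (r a) = 0)
    (hcard : f.natDegree = Fintype.card α) : ∏ a, (X - C (r a)) = f := by
  refine (eq_of_monic_of_dvd_of_natDegree_le (monic_prod_X_sub_C _ _) hf ?_ ?_).symm
  · exact Finset.prod_dvd_of_coprime
      (fun _ _ _ _ hab => pairwise_coprime_X_sub_C hr hab) fun a _ => dvd_iff_isRoot.mpr (hroot a)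
  · rw [natDegree_finsetProd_X_sub_C_eq_card, Finset.card_univ, hcard]

/-- The required number of points forces f to have distinct roots, so f is the product over its
roots and the product of `max 1 ‖r z‖` is its Mahler measure, which is at most the sum of the
absolute values of its coefficients. -/
theorem exists_tuple_of_imprimitive {n k L : ℕ} (hn : 0 < n) (hL : 1 ≤ L)
    {a : Fin (n * (k + 1)) → ℤ} (ha : a ∈ coeffBox (n * (k + 1)) L)
    (h : IsTransitiveImprimitive (galoisPermGroup (monicPoly (n * (k + 1)) a)) n (k + 1)) :
    ∃ (ρ : Gal(QBar/ℚ) → Fin n → Fin n) (x : Fin (k + 1) → Fin n → QBar),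
      IsTransitiveAction ρ ∧ (∀ j, x j ∈ equivariantIntegers ρ) ∧
      (Function.Injective fun i j => x j i) ∧
      (∏ i, (X ^ (k + 1) + ∑ j : Fin (k + 1), C (x j i) * X ^ (j : ℕ)) : Polynomial QBar) =
        (monicPoly (n * (k + 1)) a).map (Int.castRingHom QBar) ∧
      ∏ i, (1 + ∑ j, ‖x j i‖) ≤
        (1 + (k + 1) * 2 ^ (k + 1)) ^ n * (((n * (k + 1) : ℕ) + 1) * L) := by
  classical
  set f := monicPoly (n * (k + 1)) a with hf
  have hmonic : f.Monic := monicPoly_monic a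
  have hdeg : f.natDegree = n * (k + 1) := natDegree_monicPoly a
  set p := f.map (Int.castRingHom ℚ) with hp
  obtain ⟨hcard, htrans, Λ, hΛ, hΛcard, hΛG⟩ := h
  obtain ⟨blk, hsurj, hblk⟩ := exists_block_function hn hΛ hΛcard hΛG
  obtain ⟨hγg, hgγ⟩ := exists_perm_iff_galois f
  have hroot : ∀ x : p.rootSet ℂ, eval₂ (Int.castRingHom ℂ) (x : ℂ) f = 0 := by
    intro x
    have h1 : aeval (x : ℂ) (f.map (Int.castRingHom ℚ)) = 0 := (mem_rootSet.mp x.2).2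
    rwa [aeval_def, eval₂_map, RingHom.ext_int ((algebraMap ℚ ℂ).comp (Int.castRingHom ℚ))
      (Int.castRingHom ℂ)] at h1
  have hintC : ∀ x : p.rootSet ℂ, IsIntegral ℤ (x : ℂ) := fun x => ⟨f, hmonic, hroot x⟩
  let r : p.rootSet ℂ → QBar := fun x =>
    ⟨x, mem_algebraicClosure_iff.mpr (IsIntegral.isAlgebraic (hintC x).tower_top)⟩
  have hrinj : Function.Injective r := fun x y hxy =>
    Subtype.ext (congrArg (Subtype.val : QBar → ℂ) hxy)
  have hrint : ∀ x, IsIntegral ℤ (r x) := fun x =>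
    (isIntegral_algebraMap_iff (algebraMap QBar ℂ).injective).mp (hintC x)
  choose g hgmem hg using hγg
  have hr : ∀ γ x, r (g γ x) = γ (r x) := fun γ x => Subtype.ext (hg γ x (r x) rfl).symm
  have htr : ∀ x y, ∃ γ, g γ x = y := by
    intro x y
    obtain ⟨⟨σ, hσ⟩, hxy⟩ := htrans.exists_smul_eq x y
    obtain ⟨γ, hγ⟩ := hgγ σ hσ
    refine ⟨γ, hrinj ((hr γ x).trans (Subtype.ext ((hγ x (r x) rfl).trans ?_)))⟩
    exact congrArg Subtype.val hxy
  have hFcard : Fintype.card (p.rootSet ℂ) = n * (k + 1) := by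
    rw [← Nat.card_eq_fintype_card, hcard]
  obtain ⟨ρ, x, h1, h2, h3, h4, h5⟩ := exists_block_polynomials hn hFcard r hrinj hrint
    (fun γ => g γ) hr htr blk hsurj fun γ => hblk _ (hgmem γ)
  have hfQ : ∏ z, (X - C (r z)) = f.map (Int.castRingHom QBar) := by
    refine prod_X_sub_C_eq_of_card_roots hrinj (hmonic.map _) (fun z => ?_) ?_
    · rw [eval_map]
      apply (algebraMap QBar ℂ).injective
      rw [hom_eval₂, map_zero, RingHom.ext_int ((algebraMap QBar ℂ).comp (Int.castRingHom QBar))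
        (Int.castRingHom ℂ)]
      exact hroot z
    · rw [hmonic.natDegree_map, hFcard, hdeg]
  refine ⟨ρ, x, h1, h2, h3, h4.trans hfQ, h5.trans ?_⟩
  have hmahler : ∏ z, max 1 ‖r z‖ = (f.map (Int.castRingHom ℂ)).mahlerMeasure := by
    have h6 : f.map (Int.castRingHom ℂ) = ∏ z, (X - C (r z : ℂ)) := by
      have h7 := congrArg (Polynomial.map (algebraMap QBar ℂ)) hfQ
      rw [Polynomial.map_map, Polynomial.map_prod] at h7
      rw [RingHom.ext_int (Int.castRingHom ℂ) ((algebraMap QBar ℂ).comp (Int.castRingHom QBar)),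
        ← h7]
      exact Finset.prod_congr rfl fun z _ => by simp
    rw [h6, mahlerMeasure_finset_prod]
    exact Finset.prod_congr rfl fun z _ => (mahlerMeasure_X_sub_C _).symm
  rw [hmahler]
  gcongr
  exact mahlerMeasure_monicPoly_le hL ha

/-! ### Comparison of exponents and conclusion -/

theorem countExponent_le_imprimitiveExponent {n k : ℕ} (hn : 1 < n) (hk : 0 < k) :
    countExponent n k ≤ imprimitiveExponent n (k + 1) := by
  have hn' : (1 : ℝ) < n := by exact_mod_cast hn
  unfold countExponent imprimitiveExponent
  split_ifs with h
  · obtain ⟨h1, h2⟩ := h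
    obtain rfl : k = 1 := by omega
    have h3 : 5 ≤ n := by omega
    have h4 : (5 : ℝ) ≤ n := by exact_mod_cast h3
    have h5 : 1 / (n : ℝ) ≤ 1 := by rw [div_le_one (by linarith)]; linarith
    -- For blocks of size 2 the claimed exponent is exactly the second term of `countExponent`.
    have h6 : ((n * (1 + 1) : ℕ) : ℝ) / 2 - 2 / ((n * (1 + 1) : ℕ) : ℝ) + 1 =
        n + 1 - 1 / n := by
      push_cast
      field_simp
      ring
    rw [h6]
    push_cast
    refine max_le (by linarith) (by linarith)
  · push_cast
    refine max_le (le_max_of_le_left ?_) (le_max_of_le_right (le_max_of_le_left ?_))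
    · have : 0 ≤ 1 / (n : ℝ) := by positivity
      linarith
    · rw [add_sub_cancel_right]

theorem theorem1p4 (n n₁ n₂ : ℕ) (hn : n = n₁ * n₂) (hn₁ : 1 < n₁) (hn₂ : 1 < n₂)
    (ε : ℝ) (hε : 0 < ε) :
    ∃ K : ℝ, 0 < K ∧ ∀ L : ℕ, 1 ≤ L →
      boxProb n L (fun f => IsTransitiveImprimitive (galoisPermGroup f) n₁ n₂)
        ≤ K * (L : ℝ) ^ (-(n : ℝ) + imprimitiveExponent n₁ n₂ + ε) := by
  classical
  obtain ⟨k, rfl⟩ : ∃ k, n₂ = k + 1 := ⟨n₂ - 1, by omega⟩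
  subst hn
  have hk : 0 < k := by omega
  obtain ⟨K, hK, hmain⟩ := card_tuples_le (n := n₁) (by omega) k hε
  set n := n₁ * (k + 1) with hn
  set D : ℝ := (1 + (k + 1) * 2 ^ (k + 1)) ^ n₁ * ((n : ℝ) + 1) with hD
  have hD1 : 1 ≤ D := by
    refine one_le_mul_of_one_le_of_one_le (one_le_pow₀ ?_) ?_
    · exact le_add_of_nonneg_right (by positivity)
    · exact le_add_of_nonneg_left (by positivity)
  set e := countExponent n₁ k with he
  refine ⟨K * D ^ (e + ε), by positivity, fun L hL => ?_⟩
  have hL' : (1 : ℝ) ≤ L := by exact_mod_cast hL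
  set S := (coeffBox n L).filter fun a =>
    IsTransitiveImprimitive (galoisPermGroup (monicPoly n a)) n₁ (k + 1) with hS
  have hex : ∀ a : Fin n → ℤ, ∃ x : Fin (k + 1) → Fin n₁ → QBar, a ∈ S →
      (∃ ρ, IsTransitiveAction ρ ∧ (∀ j, x j ∈ equivariantIntegers ρ) ∧
        (Function.Injective fun i j => x j i) ∧ ∏ i, (1 + ∑ j, ‖x j i‖) ≤ D * L) ∧
      (∏ i, (X ^ (k + 1) + ∑ j : Fin (k + 1), C (x j i) * X ^ (j : ℕ)) : Polynomial QBar) =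
        (monicPoly n a).map (Int.castRingHom QBar) := by
    intro a
    by_cases ha : a ∈ S
    · obtain ⟨hbox, himp⟩ := Finset.mem_filter.mp ha
      obtain ⟨ρ, x, h1, h2, h3, h4, h5⟩ := exists_tuple_of_imprimitive (by omega) hL hbox himp
      exact ⟨x, fun _ => ⟨⟨ρ, h1, h2, h3, h5.trans_eq (by rw [hD]; ring)⟩, h4⟩⟩
    · exact ⟨0, fun h => absurd h ha⟩
  choose x hx using hex
  -- The tuple determines the polynomial, which is the product of the block factors.
  have hinj : Set.InjOn x S := by
    intro a ha b hb hab
    have h1 := (hx a ha).2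
    rw [hab, (hx b hb).2] at h1
    exact monicPoly_injective n
      (map_injective _ (RingHom.injective_int (Int.castRingHom QBar)) h1).symm
  have hDL : 1 ≤ D * L := one_le_mul_of_one_le_of_one_le hD1 hL'
  have hcard := hmain (D * L) hDL (S.image x) (by
    intro y hy
    obtain ⟨a, ha, rfl⟩ := Finset.mem_image.mp hy
    exact (hx a ha).1)
  rw [Finset.card_image_of_injOn hinj] at hcard
  have hbox : (L : ℝ) ^ n ≤ (coeffBox n L).card := by
    rw [coeffBox, Fintype.card_piFinset_const, Int.card_Icc]
    have : L ≤ ((L : ℤ) + 1 - -(L : ℤ)).toNat := by omega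
    exact_mod_cast Nat.pow_le_pow_left this n
  have hLn : (0 : ℝ) < (L : ℝ) ^ n := by positivity
  have hprob : boxProb n L
      (fun f => IsTransitiveImprimitive (galoisPermGroup f) n₁ (k + 1)) =
      (S.card : ℝ) / (coeffBox n L).card := by
    rw [boxProb, hS]
  rw [hprob]
  calc (S.card : ℝ) / (coeffBox n L).card ≤ (K * (D * L) ^ (e + ε)) / (L : ℝ) ^ n := by
        gcongr
    _ = K * D ^ (e + ε) * (L : ℝ) ^ (-(n : ℝ) + e + ε) := by
        rw [Real.mul_rpow (by positivity) (by positivity), add_assoc (-(n : ℝ)),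
          Real.rpow_add (by positivity) (-(n : ℝ)), Real.rpow_neg (by positivity),
          Real.rpow_natCast]
        field_simp
    _ ≤ _ := by
        gcongr
        exact countExponent_le_imprimitiveExponent hn₁ hk
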